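/- **Setting.** Fix a countably infinite set $\Delta$ of constants (standard names: distinct constants denote distinct objects) and a finite set of service functions. A DL-Lite$_{\mathcal A}$ TBox $T$ is a finite set of positive inclusions $B_1\sqsubseteq B_2$, $R_1\sqsubseteq R_2$, negative inclusions $B_1\sqsubseteq\neg B_2$, $R_1\sqsubseteq\neg R_2$, and functionality assertions $(\mathsf{funct}\ R)$, where $R::=P\mid P^-$ and $B::=N\mid\exists R$, such that if $(\mathsf{funct}\ R)\in T$ then neither $R$ nor $R^-$ is the right-hand side of a positive role inclusion of $T$. An ABox is a finite set of facts $N(c)$, $P(c,c')$ over $\Delta$; $\mathrm{adom}(A)$ is the set of constants in $A$; $A$ is $T$-consistent if $(T,A)$ has a model. In a UCQ $q$, every free variable occurs in every disjunct; its answers over $(T,A)$ are the assignments of its free variables in $\mathrm{adom}(A)$ that make $q$ true in all models of $(T,A)$. ECQs are built from UCQs, evaluated in this way, by $\neg,\wedge,\exists$, with quantifiers ranging over $\mathrm{adom}(A)$. A *KAB* is $\mathcal K=(T,A_0,\Gamma,\Pi)$ with a DL-Lite$_{\mathcal A}$ TBox $T$, a $T$-consistent ABox $A_0$, a finite set $\Gamma$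 of actions (each with input parameters and a finite set of effects $[q^+]\wedge Q^-\rightsquigarrow A'$, where $q^+$ is a UCQ, $Q^-$ is an ECQ whose free variables are among those of $q^+$, and $A'$ is a finite set of facts whose terms are individuals of $A_0$, free variables of $q^+$, or service calls $f(\vec x)$ on free variables $\vec x$ of $q^+$), and a finite set $\Pi$ of rules $Q\mapsto\alpha$ with $\alpha\in\Gamma$ and $Q$ an ECQ whose free variables are exactly the parameters of $\alpha$. **Transition systems.** States are pairs $\langle A,m\rangle$ of an ABox and a partial map $m$ from service calls $f(\vec v)$, $\vec v$ over $\Delta$, to $\Delta$; the initial state is $\langle A_0,\emptyset\rangle$. Executing $\alpha\in\Gamma$ in $\langle A,m\rangle$ with parameters $\sigma$ is possible if $\sigma$ is an answer over $(T,A)$ to $Q$ for some rule $Q\mapsto\alpha$ in $\Pi$. Let $E$ be the union, over the effects of $\alpha$ and over the answers $\rho$ of $([q^+]\wedge Q^-)\sigma$ over $(T,A)$, of the sets $A'\sigma\rho$. The result is any $\langle E\theta,m\cup\theta\rangle$, where $\theta$ maps the service calls in $E$ to $\Delta$ and agrees with $m$ on common arguments. All systems below consist of the states reachable from the initial one. *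 $\Upsilon^{s}_{\mathcal K}$ (standard): the transitions are the executions of actions whose resulting ABox is $T$-consistent. * $\Upsilon^{b}_{\mathcal K}$ (bold) and $\Upsilon^{c}_{\mathcal K}$ (certain): let $\mathsf{State}$ be a fresh concept name and $\mathit{temp}\in\Delta$. If $\mathsf{State}(\mathit{temp})\notin A$, then the successors of $\langle A,m\rangle$ are all $\langle A'\cup\{\mathsf{State}(\mathit{temp})\},m'\rangle$ such that executing an action in $\langle A,m\rangle$ can result in $\langle A',m'\rangle$. If $\mathsf{State}(\mathit{temp})\in A$, they are all $\langle A',m\rangle$ with $A'$ a maximal $T$-consistent subset of $A\setminus\{\mathsf{State}(\mathit{temp})\}$ (bold), respectively with $A'$ the intersection of all these maximal subsets (certain). * $\Upsilon^{eb}_{\mathcal K}$ and $\Upsilon^{ec}_{\mathcal K}$ (extended bold, extended certain): as $\Upsilon^{b}_{\mathcal K}$ and $\Upsilon^{c}_{\mathcal K}$, but the repair step from $\langle A,m\rangle$ adds to $A'$ the facts $\mathsf{Viol}(\mathrm{label}(t))$ for all functionality assertions and negative inclusions $t\in T$ that are violated by $A\setminus\{\mathsf{State}(\mathit{temp})\}$.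 Here $\mathsf{Viol}$ is a fresh concept name and $\mathrm{label}$ assigns constants of $\Delta$ to TBox assertions; $(\mathsf{funct}\ R)$ is violated by an ABox if the latter contains $R(c,c_1)$ and $R(c,c_2)$ with $c_1\ne c_2$ ($P^-(c,c')$ standing for $P(c',c)$), and a negative inclusion is violated if the perfect rewriting with respect to the positive inclusions of $T$ of the boolean query $\exists x\,(B_1(x)\wedge B_2(x))$, respectively $\exists x,y\,(R_1(x,y)\wedge R_2(x,y))$, is true in the ABox considered as a database. A *run* is a finite or infinite path from the initial state. A transition system is *run-bounded* if there is one $b\in\mathbb N$ such that for every run the union of the active domains of the ABoxes of its states has fewer than $b$ elements. **Weak acyclicity.** Let $\mathrm{rew}(q^+,T)$ be the perfect rewriting of $q^+$: the UCQ obtained by exhaustively applying the positive inclusions of $T$ from right to left to atoms (an inclusion with right-hand side $\exists R$ only to an atom $R(t,y)$ in which $y$ is an existential variable with no other occurrence) and replacing the query by its image under a most general unifier of two of its atoms. If such a unifier identifies a free variable $x$ with another variable, then occurrences of the resulting variable count as occurrences of $x$. The *dependency graph* of $\mathcal K$ has a node $\langle N,1\rangle$ for each concept name $N$ and nodes $\langle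 P,1\rangle$, $\langle P,2\rangle$ for each role name $P$. There is an *ordinary* (respectively *special*) edge from $u$ to $v$ whenever some effect $[q^+]\wedge Q^-\rightsquigarrow A'$ of an action of $\Gamma$ and some free variable $x$ of $q^+$ (possibly an action parameter) are such that $x$ occurs at position $u$ in an atom of $\mathrm{rew}(q^+,T)$, and $x$ itself (respectively a service call having $x$ among its arguments) occurs at position $v$ in a fact of $A'$. $\mathcal K$ is *weakly acyclic* if no cycle of this graph contains a special edge. **Theorem 5.** If $\mathcal K$ is a weakly acyclic KAB, then $\Upsilon^{s}_{\mathcal K}$, $\Upsilon^{b}_{\mathcal K}$, $\Upsilon^{c}_{\mathcal K}$, $\Upsilon^{eb}_{\mathcal K}$ and $\Upsilon^{ec}_{\mathcal K}$ are all run-bounded. -/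

import Mathlib

universe u

namespace KABs

/-! ### DL-Lite_A syntax -/

/-- Role expressions `P` and `P⁻`. -/
inductive Role (NR : Type u) : Type u
  | name (P : NR)
  | inv (P : NR)

/-- The inverse of a role expression. -/
def Role.inverse {NR : Type u} : Role NR → Role NR
  | .name P => .inv P
  | .inv P => .name P

/-- Basic concepts `N` and `∃R`. -/
inductive BasicConcept (NC NR : Type u) : Type u
  | name (N : NC)
  | ex (R : Role NR)

/-- TBox assertions: positive inclusions `B₁ ⊑ B₂`, `R₁ ⊑ R₂`, negative inclusions `B₁ ⊑ ¬B₂`,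
`R₁ ⊑ ¬R₂`, and functionality assertions `(funct R)`. -/
inductive Assertion (NC NR : Type u) : Type u
  | conceptIncl (B₁ B₂ : BasicConcept NC NR)
  | roleIncl (R₁ R₂ : Role NR)
  | conceptDisj (B₁ B₂ : BasicConcept NC NR)
  | roleDisj (R₁ R₂ : Role NR)
  | funct (R : Role NR)

/-- A DL-Lite_A TBox: a finite set of assertions in which no functional role is specialized. -/
structure TBox (NC NR : Type u) : Type u where
  assertions : Finset (Assertion NC NR)
  funct_not_specialized : ∀ R, Assertion.funct R ∈ assertions →
    ∀ S S', Assertion.roleIncl S S' ∈ assertions → S' ≠ R ∧ S' ≠ R.inverse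

/-- The concept names that may occur in the ABoxes of a transition system: the concept names of
the knowledge base, and the two fresh names `State` and `Viol`, which occur neither in the TBox, nor
in the initial ABox, nor in queries and effects, because these are written over `NC`. -/
inductive ConceptName (NC : Type u) : Type u
  | base (N : NC)
  | state
  | viol

/-- Expressions `N(t)` and `P(t₁,t₂)` over terms of type `τ`. -/
inductive Fact (NC NR τ : Type u) : Type u
  | concept (N : NC) (t : τ)
  | role (P : NR) (t₁ t₂ : τ)

/-- The terms of an atom. -/
def Fact.args {NC NR τ : Type u} : Fact NC NR τ → List τ
  | .concept _ t => [t]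
  | .role _ t₁ t₂ => [t₁, t₂]

/-- Apply a map to the concept names and a map to the terms. -/
def Fact.map {NC NC' NR τ τ' : Type u} (g : NC → NC') (h : τ → τ') :
    Fact NC NR τ → Fact NC' NR τ'
  | .concept N t => .concept (g N) (h t)
  | .role P t₁ t₂ => .role P (h t₁) (h t₂)

/-- Sets of membership assertions over the vocabulary extended with `State` and `Viol`. -/
abbrev ABox (NC NR Δ : Type u) : Type u := Set (Fact (ConceptName NC) NR Δ)

/-- The active domain of an ABox. -/
def adom {NC NR Δ : Type u} (A : ABox NC NR Δ) : Set Δ := {c | ∃ φ ∈ A, c ∈ φ.args}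

/-! ### First-order semantics -/

/-- First-order interpretations with domain `D`. Distinct individuals denote distinct elements
(unique names, as always in DL-Lite_A). -/
structure Interp (NC NR Δ D : Type u) : Type u where
  conc : ConceptName NC → Set D
  role : NR → D → D → Prop
  const : Δ → D
  const_injective : Function.Injective const

namespace Interp

variable {NC NR Δ D : Type u}

def roleExt (I : Interp NC NR Δ D) : Role NR → D → D → Prop
  | .name P, a, b => I.role P a b
  | .inv P, a, b => I.role P b a

def conceptExt (I : Interp NC NR Δ D) : BasicConcept NC NR → Set D
  | .name N => I.conc (.base N)
  | .ex R => {a | ∃ b, I.roleExt R a b}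

def SatAssertion (I : Interp NC NR Δ D) : Assertion NC NR → Prop
  | .conceptIncl B₁ B₂ => ∀ a, a ∈ I.conceptExt B₁ → a ∈ I.conceptExt B₂
  | .roleIncl R₁ R₂ => ∀ a b, I.roleExt R₁ a b → I.roleExt R₂ a b
  | .conceptDisj B₁ B₂ => ∀ a, a ∈ I.conceptExt B₁ → a ∉ I.conceptExt B₂
  | .roleDisj R₁ R₂ => ∀ a b, I.roleExt R₁ a b → ¬ I.roleExt R₂ a b
  | .funct R => ∀ a b c, I.roleExt R a b → I.roleExt R a c → b = c

/-- Satisfaction of an atom over elements of the domain. -/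
def SatAtom (I : Interp NC NR Δ D) : Fact (ConceptName NC) NR D → Prop
  | .concept N a => a ∈ I.conc N
  | .role P a b => I.role P a b

/-- `I` is a model of the knowledge base `(T, A)`. -/
def IsModel (I : Interp NC NR Δ D) (T : TBox NC NR) (A : ABox NC NR Δ) : Prop :=
  (∀ t ∈ T.assertions, I.SatAssertion t) ∧ ∀ φ ∈ A, I.SatAtom (φ.map id I.const)

end Interp

/-- `A` is `T`-consistent: `(T, A)` has a model. -/
def Consistent {NC NR Δ : Type u} (T : TBox NC NR) (A : ABox NC NR Δ) : Prop :=
  ∃ (D : Type u) (I : Interp NC NR Δ D), I.IsModel T A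

/-! ### Queries -/

/-- Query terms: variables and constants. -/
inductive Term (Δ : Type u) : Type u
  | var (x : ℕ)
  | const (c : Δ)

/-- The value of a term, for an assignment `w` and an interpretation `k` of the constants. -/
def Term.eval {Δ D : Type u} (k : Δ → D) (w : ℕ → D) : Term Δ → D
  | .var x => w x
  | .const c => k c

/-- Apply a substitution to a term. -/
def Term.subst {Δ : Type u} (s : ℕ → Term Δ) : Term Δ → Term Δ
  | .var x => s x
  | .const c => .const c

/-- Query atoms. -/
abbrev Atom (NC NR Δ : Type u) : Type u := Fact NC NR (Term Δ)

/-- Unions of conjunctive queries with free variables `free`. Each disjunct is a conjunction of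
atoms whose variables outside `free` are existentially quantified; every free variable occurs in
each disjunct. -/
structure UCQ (NC NR Δ : Type u) : Type u where
  free : Finset ℕ
  disjuncts : Finset (Finset (Atom NC NR Δ))
  safe : ∀ d ∈ disjuncts, ∀ x ∈ free, ∃ a ∈ d, Term.var x ∈ a.args

section Queries

variable {NC NR Δ : Type u}

/-- The query, with its free variables replaced according to `v`, is true in every model. -/
def UCQ.Certain (q : UCQ NC NR Δ) (T : TBox NC NR) (A : ABox NC NR Δ) (v : ℕ → Δ) : Prop :=
  ∀ (D : Type u) (I : Interp NC NR Δ D), I.IsModel T A →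
    ∃ d ∈ q.disjuncts, ∃ w : ℕ → D, (∀ x ∈ q.free, w x = I.const (v x)) ∧
      ∀ a ∈ d, I.SatAtom (a.map ConceptName.base (Term.eval I.const w))

/-- The restriction of `v` to the free variables is a certain answer to `q` over `(T, A)`. -/
def UCQ.IsAnswer (q : UCQ NC NR Δ) (T : TBox NC NR) (A : ABox NC NR Δ) (v : ℕ → Δ) : Prop :=
  (∀ x ∈ q.free, v x ∈ adom A) ∧ q.Certain T A v

end Queries

/-- EQL-Lite(UCQ) queries. -/
inductive ECQ (NC NR Δ : Type u) : Type u
  | ucq (q : UCQ NC NR Δ)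
  | neg (Q : ECQ NC NR Δ)
  | and (Q₁ Q₂ : ECQ NC NR Δ)
  | ex (x : ℕ) (Q : ECQ NC NR Δ)

namespace ECQ

variable {NC NR Δ : Type u}

def free : ECQ NC NR Δ → Finset ℕ
  | .ucq q => q.free
  | .neg Q => Q.free
  | .and Q₁ Q₂ => Q₁.free ∪ Q₂.free
  | .ex x Q => Q.free.erase x

/-- Composition of the certain answers through the first-order constructs; quantified variables
range over the active domain. -/
def Holds (T : TBox NC NR) (A : ABox NC NR Δ) : ECQ NC NR Δ → (ℕ → Δ) → Prop
  | .ucq q, v => q.IsAnswer T A v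
  | .neg Q, v => ¬ Q.Holds T A v
  | .and Q₁ Q₂, v => Q₁.Holds T A v ∧ Q₂.Holds T A v
  | .ex x Q, v => ∃ c ∈ adom A, Q.Holds T A (Function.update v x c)

/-- The restriction of `v` to the free variables is an answer to `Q` over `(T, A)`. -/
def IsAnswer (Q : ECQ NC NR Δ) (T : TBox NC NR) (A : ABox NC NR Δ) (v : ℕ → Δ) : Prop :=
  (∀ x ∈ Q.free, v x ∈ adom A) ∧ Q.Holds T A v

end ECQ

/-! ### Perfect rewriting -/

section Rewriting

variable {NC NR Δ : Type u}

/-- The atom `η(R,t,t')`: `P(t,t')` if `R = P`, and `P(t',t)` if `R = P⁻`. -/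
def Role.atom (R : Role NR) (t t' : Term Δ) : Atom NC NR Δ :=
  match R with
  | .name P => .role P t t'
  | .inv P => .role P t' t

/-- The atom `γ(B,t)`, in which `z` is used for the anonymous argument, if there is one. -/
def BasicConcept.atom (B : BasicConcept NC NR) (t z : Term Δ) : Atom NC NR Δ :=
  match B with
  | .name N => .concept N t
  | .ex R => R.atom t z

/-- A conjunctive query produced in the course of the rewriting: its head and its body. The term
`head x` is the one that stands at the place of the answer variable `x` of the original query (a
unification may have replaced `x` by a constant, or by another variable). -/
structure CQ (NC NR Δ : Type u) : Type u where
  head : ℕ → Term Δ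
  body : Set (Atom NC NR Δ)

/-- `z` does not occur in the query, whose answer variables are `F`. -/
def CQ.Fresh (F : Finset ℕ) (q : CQ NC NR Δ) (z : ℕ) : Prop :=
  (∀ x ∈ F, q.head x ≠ .var z) ∧ ∀ a ∈ q.body, Term.var z ∉ a.args

/-- `y` is neither distinguished (in the head) nor shared (with two occurrences in the body). -/
def CQ.Unbound (F : Finset ℕ) (q : CQ NC NR Δ) (y : ℕ) : Prop :=
  (∀ x ∈ F, q.head x ≠ .var y) ∧
  (∀ a ∈ q.body, ∀ b ∈ q.body, Term.var y ∈ a.args → Term.var y ∈ b.args → a = b) ∧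
  ∀ P, Fact.role P (.var y) (.var y) ∉ q.body

/-- Replace the atom `a` by the atom `b` in the body. -/
def CQ.replace (q : CQ NC NR Δ) (a b : Atom NC NR Δ) : CQ NC NR Δ :=
  ⟨q.head, insert b (q.body \ {a})⟩

/-- Apply a substitution to an atom. -/
def substAtom (s : ℕ → Term Δ) (a : Atom NC NR Δ) : Atom NC NR Δ := a.map id (Term.subst s)

/-- Apply a substitution to the head and the body of a query. -/
def CQ.subst (s : ℕ → Term Δ) (q : CQ NC NR Δ) : CQ NC NR Δ :=
  ⟨fun x => (q.head x).subst s, substAtom s '' q.body⟩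

/-- `s` is a most general unifier of the atoms `a` and `b`. -/
def IsMGU (s : ℕ → Term Δ) (a b : Atom NC NR Δ) : Prop :=
  substAtom s a = substAtom s b ∧
  ∀ s' : ℕ → Term Δ, substAtom s' a = substAtom s' b →
    ∃ r : ℕ → Term Δ, ∀ x, s' x = (s x).subst r

/-- One step of the reformulation algorithm for a conjunctive query with answer variables `F`:
a positive inclusion is applied, from right to left, to an atom, or two atoms are unified. -/
inductive RewStep (T : TBox NC NR) (F : Finset ℕ) : CQ NC NR Δ → CQ NC NR Δ → Prop
  | conceptName (q : CQ NC NR Δ) (B : BasicConcept NC NR) (N : NC) (t : Term Δ) (z : ℕ) :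
      Assertion.conceptIncl B (.name N) ∈ T.assertions → Fact.concept N t ∈ q.body →
      q.Fresh F z →
      RewStep T F q (q.replace (Fact.concept N t) (B.atom t (.var z)))
  | existsRole (q : CQ NC NR Δ) (B : BasicConcept NC NR) (R : Role NR) (t : Term Δ) (y z : ℕ) :
      Assertion.conceptIncl B (.ex R) ∈ T.assertions → R.atom t (.var y) ∈ q.body →
      q.Unbound F y → q.Fresh F z →
      RewStep T F q (q.replace (R.atom t (.var y)) (B.atom t (.var z)))
  | role (q : CQ NC NR Δ) (R₁ R₂ : Role NR) (t t' : Term Δ) :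
      Assertion.roleIncl R₁ R₂ ∈ T.assertions → R₂.atom t t' ∈ q.body →
      RewStep T F q (q.replace (R₂.atom t t') (R₁.atom t t'))
  | reduce (q : CQ NC NR Δ) (a b : Atom NC NR Δ) (s : ℕ → Term Δ) :
      a ∈ q.body → b ∈ q.body → a ≠ b → IsMGU s a b →
      RewStep T F q (q.subst s)

/-- The perfect rewriting of a conjunctive query. -/
def rewCQ (T : TBox NC NR) (F : Finset ℕ) (q : CQ NC NR Δ) : Set (CQ NC NR Δ) :=
  {r | Relation.ReflTransGen (RewStep T F) q r}

/-- The perfect rewriting of a union of conjunctive queries. -/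
def UCQ.rew (T : TBox NC NR) (q : UCQ NC NR Δ) : Set (CQ NC NR Δ) :=
  {r | ∃ d ∈ q.disjuncts, r ∈ rewCQ T q.free ⟨Term.var, {a | a ∈ d}⟩}

/-- The ABox, considered as a database, satisfies the existential closure of the body of `r`. -/
def CQ.TrueIn (r : CQ NC NR Δ) (A : ABox NC NR Δ) : Prop :=
  ∃ w : ℕ → Δ, ∀ a ∈ r.body, a.map ConceptName.base (Term.eval id w) ∈ A

end Rewriting

/-! ### Knowledge and action bases -/

/-- Terms in the facts of an effect: individuals, variables, and service calls on variables. -/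
inductive HeadTerm (FN Δ : Type u) : Type u
  | const (c : Δ)
  | var (x : ℕ)
  | call (f : FN) (xs : List ℕ)

/-- The variables of such a term. -/
def HeadTerm.vars {FN Δ : Type u} : HeadTerm FN Δ → Set ℕ
  | .const _ => ∅
  | .var x => {x}
  | .call _ xs => {x | x ∈ xs}

/-- Service calls `f(v₁,…,vₙ)` on values. The function called is given by its name and its number
of arguments. -/
structure ServiceCall (FN Δ : Type u) : Type u where
  fn : FN
  args : List Δ

/-- Replace the variables of a term by values. -/
def HeadTerm.ground {FN Δ : Type u} (v : ℕ → Δ) : HeadTerm FN Δ → Δ ⊕ ServiceCall FN Δ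
  | .const c => .inl c
  | .var x => .inl (v x)
  | .call f xs => .inr ⟨f, xs.map v⟩

/-- Effect specifications `[q⁺] ∧ Q⁻ ↝ A'`. -/
structure Effect (NC NR FN Δ : Type u) : Type u where
  pos : UCQ NC NR Δ
  neg : ECQ NC NR Δ
  head : Finset (Fact NC NR (HeadTerm FN Δ))
  neg_free : neg.free ⊆ pos.free
  head_vars : ∀ φ ∈ head, ∀ t ∈ φ.args, ∀ x ∈ t.vars, x ∈ pos.free

/-- Actions: input parameters (which are variables) and effects. -/
structure Action (NC NR FN Δ : Type u) : Type u where
  params : List ℕ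
  effects : Finset (Effect NC NR FN Δ)

/-- Knowledge and action bases `(T, A₀, Γ, Π)`. -/
structure KAB (NC NR FN Δ : Type u) : Type u where
  tbox : TBox NC NR
  abox₀ : Finset (Fact NC NR Δ)
  actions : Finset (Action NC NR FN Δ)
  process : Finset (ECQ NC NR Δ × Action NC NR FN Δ)
  consistent₀ : Consistent tbox {φ | ∃ ψ ∈ abox₀, φ = ψ.map ConceptName.base id}
  rule_action : ∀ π ∈ process, π.2 ∈ actions
  rule_free : ∀ π ∈ process, ∀ x, x ∈ π.1.free ↔ x ∈ π.2.params
  head_const : ∀ α ∈ actions, ∀ e ∈ α.effects, ∀ φ ∈ e.head, ∀ c,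
    HeadTerm.const c ∈ φ.args → ∃ ψ ∈ abox₀, c ∈ ψ.args

/-! ### Transition systems -/

/-- Transition systems whose states are labelled with ABoxes. -/
structure TransitionSystem (NC NR Δ : Type u) : Type (u + 1) where
  State : Type u
  states : Set State
  init : State
  abox : State → ABox NC NR Δ
  trans : State → State → Prop

namespace TransitionSystem

variable {NC NR Δ : Type u}

/-- `s` is a run with `len` transitions (possibly infinitely many) from the initial state; if `len`
is finite, then the values of `s` beyond `len` are irrelevant. -/
def IsRun (Υ : TransitionSystem NC NR Δ) (s : ℕ → Υ.State) (len : ℕ∞) : Prop :=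
  s 0 = Υ.init ∧ ∀ i : ℕ, ((i + 1 : ℕ) : ℕ∞) ≤ len → Υ.trans (s i) (s (i + 1))

/-- One bound holds for the number of values in the states of any run. -/
def RunBounded (Υ : TransitionSystem NC NR Δ) : Prop :=
  ∃ b : ℕ, ∀ (s : ℕ → Υ.State) (len : ℕ∞), Υ.IsRun s len →
    (⋃ i ∈ {i : ℕ | (i : ℕ∞) ≤ len}, adom (Υ.abox (s i))).encard < (b : ℕ∞)

end TransitionSystem

/-- States `⟨A, m⟩`: an ABox and a service call map (a partial function). -/
structure KState (NC NR FN Δ : Type u) : Type u where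
  abox : ABox NC NR Δ
  scmap : ServiceCall FN Δ → Option Δ

/-- The transition system generated from `s₀` by a step relation: the least set of states that
contains `s₀` and is closed under steps, with the steps between these states as transitions. -/
def generate {NC NR FN Δ : Type u} (s₀ : KState NC NR FN Δ)
    (step : KState NC NR FN Δ → KState NC NR FN Δ → Prop) : TransitionSystem NC NR Δ where
  State := KState NC NR FN Δ
  states := {s | Relation.ReflTransGen step s₀ s}
  init := s₀
  abox := KState.abox
  trans s s' := Relation.ReflTransGen step s₀ s ∧ step s s'

/-- `A'` is a bold repair of `A`: a maximal `T`-consistent subset. -/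
def IsBoldRepair {NC NR Δ : Type u} (T : TBox NC NR) (A A' : ABox NC NR Δ) : Prop :=
  Maximal (fun B : ABox NC NR Δ => B ⊆ A ∧ Consistent T B) A'

/-- `A'` is the certain repair of `A`: the intersection of all bold repairs. -/
def IsCertainRepair {NC NR Δ : Type u} (T : TBox NC NR) (A A' : ABox NC NR Δ) : Prop :=
  A' = ⋂₀ {B | IsBoldRepair T A B}

/-- The ABox `A` violates an assertion, detected by the queries `q_unsat` (a functionality assertion
is checked on `A`, a negative inclusion by a rewritten boolean query). -/
def Violates {NC NR Δ : Type u} (T : TBox NC NR) (A : ABox NC NR Δ) : Assertion NC NR → Prop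
  | .conceptIncl _ _ => False
  | .roleIncl _ _ => False
  | .funct R => ∃ c c₁ c₂ : Δ,
      (R.atom (.const c) (.const c₁) : Atom NC NR Δ).map ConceptName.base
        (Term.eval id fun _ => c) ∈ A ∧
      (R.atom (.const c) (.const c₂) : Atom NC NR Δ).map ConceptName.base
        (Term.eval id fun _ => c) ∈ A ∧ c₁ ≠ c₂
  | .conceptDisj B₁ B₂ =>
      ∃ r ∈ rewCQ T ∅ (⟨Term.var, {B₁.atom (.var 0) (.var 1), B₂.atom (.var 0) (.var 2)}⟩ :
        CQ NC NR Δ), r.TrueIn A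
  | .roleDisj R₁ R₂ =>
      ∃ r ∈ rewCQ T ∅ (⟨Term.var, {R₁.atom (.var 0) (.var 1), R₂.atom (.var 0) (.var 1)}⟩ :
        CQ NC NR Δ), r.TrueIn A

/-- The facts `Viol(d)`, for the labels `d` of the assertions of `T` that `A` violates. -/
def violFacts {NC NR Δ : Type u} (label : Assertion NC NR → Δ) (T : TBox NC NR)
    (A : ABox NC NR Δ) : ABox NC NR Δ :=
  {φ | ∃ t ∈ T.assertions, Violates T A t ∧ φ = .concept .viol (label t)}

namespace KAB

variable {NC NR FN Δ : Type u}

/-- The set of facts `DO(T, A, ασ)`, which may contain service calls. An assignment `v` of the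
variables combines `σ` (on the parameters) with the answer (on the other free variables). -/
def doFacts (T : TBox NC NR) (A : ABox NC NR Δ) (α : Action NC NR FN Δ) (σ : ℕ → Δ) :
    Set (Fact NC NR (Δ ⊕ ServiceCall FN Δ)) :=
  {φ | ∃ e ∈ α.effects, ∃ v : ℕ → Δ, (∀ p ∈ α.params, v p = σ p) ∧
    e.pos.IsAnswer T A v ∧ e.neg.IsAnswer T A v ∧
    ∃ h ∈ e.head, φ = h.map id (HeadTerm.ground v)}

/-- The service calls in a set of facts. -/
def calls (E : Set (Fact NC NR (Δ ⊕ ServiceCall FN Δ))) : Set (ServiceCall FN Δ) :=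
  {c | ∃ φ ∈ E, Sum.inr c ∈ φ.args}

/-- `σ` is a legal parameter assignment for `α`, according to the process. -/
def Legal (K : KAB NC NR FN Δ) (A : ABox NC NR Δ) (α : Action NC NR FN Δ) (σ : ℕ → Δ) : Prop :=
  ∃ Q, (Q, α) ∈ K.process ∧ Q.IsAnswer K.tbox A σ

/-- The relation `EXEC`: the execution of `ασ` leads from `s` to `s'`, where `θ` evaluates the
service calls that are issued, in agreement with the results known so far. -/
def Exec (K : KAB NC NR FN Δ) (s : KState NC NR FN Δ) (α : Action NC NR FN Δ) (σ : ℕ → Δ)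
    (s' : KState NC NR FN Δ) : Prop :=
  K.Legal s.abox α σ ∧
  ∃ θ : ServiceCall FN Δ → Δ,
    (∀ c ∈ calls (doFacts K.tbox s.abox α σ), ∀ d, s.scmap c = some d → θ c = d) ∧
    s'.abox = Fact.map ConceptName.base (Sum.elim id θ) '' doFacts K.tbox s.abox α σ ∧
    (∀ c ∈ calls (doFacts K.tbox s.abox α σ), s'.scmap c = some (θ c)) ∧
    ∀ c ∉ calls (doFacts K.tbox s.abox α σ), s'.scmap c = s.scmap c

/-- The initial state `⟨A₀, ∅⟩`. -/
def initState (K : KAB NC NR FN Δ) : KState NC NR FN Δ where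
  abox := {φ | ∃ ψ ∈ K.abox₀, φ = ψ.map ConceptName.base id}
  scmap := fun _ => none

/-- The standard transition system. -/
def standardTS (K : KAB NC NR FN Δ) : TransitionSystem NC NR Δ :=
  generate K.initState fun s s' =>
    ∃ α ∈ K.actions, ∃ σ, K.Exec s α σ s' ∧ Consistent K.tbox s'.abox

/-- The marker `State(temp)`. -/
def marker (temp : Δ) : Fact (ConceptName NC) NR Δ := .concept .state temp

/-- Alternation of action steps and repair steps. Here `rep A A'` says that `A'` is a possible
repair of `A`, and `extra A` are the facts that the repair service adds when it repairs `A`. -/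
inductive RepairStep (K : KAB NC NR FN Δ) (temp : Δ) (rep : ABox NC NR Δ → ABox NC NR Δ → Prop)
    (extra : ABox NC NR Δ → ABox NC NR Δ) : KState NC NR FN Δ → KState NC NR FN Δ → Prop
  | action (s s' : KState NC NR FN Δ) (α : Action NC NR FN Δ) (σ : ℕ → Δ) :
      marker temp ∉ s.abox → α ∈ K.actions → K.Exec s α σ s' →
      RepairStep K temp rep extra s ⟨s'.abox ∪ {marker temp}, s'.scmap⟩
  | repair (s : KState NC NR FN Δ) (A' : ABox NC NR Δ) :
      marker temp ∈ s.abox → rep (s.abox \ {marker temp}) A' →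
      RepairStep K temp rep extra s ⟨A' ∪ extra (s.abox \ {marker temp}), s.scmap⟩

/-- The b-transition system. -/
def boldTS (K : KAB NC NR FN Δ) (temp : Δ) : TransitionSystem NC NR Δ :=
  generate K.initState (RepairStep K temp (IsBoldRepair K.tbox) fun _ => ∅)

/-- The c-transition system. -/
def certainTS (K : KAB NC NR FN Δ) (temp : Δ) : TransitionSystem NC NR Δ :=
  generate K.initState (RepairStep K temp (IsCertainRepair K.tbox) fun _ => ∅)

/-- The eb-transition system. -/
def extBoldTS (K : KAB NC NR FN Δ) (temp : Δ) (label : Assertion NC NR → Δ) :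
    TransitionSystem NC NR Δ :=
  generate K.initState (RepairStep K temp (IsBoldRepair K.tbox) (violFacts label K.tbox))

/-- The ec-transition system. -/
def extCertainTS (K : KAB NC NR FN Δ) (temp : Δ) (label : Assertion NC NR → Δ) :
    TransitionSystem NC NR Δ :=
  generate K.initState (RepairStep K temp (IsCertainRepair K.tbox) (violFacts label K.tbox))

end KAB

/-! ### Weak acyclicity -/

/-- The nodes `⟨N,1⟩`, `⟨P,1⟩`, `⟨P,2⟩` of the dependency graph. -/
inductive Node (NC NR : Type u) : Type u
  | concept (N : NC)
  | role₁ (P : NR)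
  | role₂ (P : NR)

/-- The atom has the term `t` at the position given by the node. -/
inductive Fact.HasAt {NC NR τ : Type u} (t : τ) : Fact NC NR τ → Node NC NR → Prop
  | concept (N : NC) : Fact.HasAt t (.concept N t) (.concept N)
  | role₁ (P : NR) (t' : τ) : Fact.HasAt t (.role P t t') (.role₁ P)
  | role₂ (P : NR) (t' : τ) : Fact.HasAt t (.role P t' t) (.role₂ P)

namespace KAB

variable {NC NR FN Δ : Type u}

/-- The variable `x` of the effect appears at position `n` in the perfect rewriting of `q⁺`. If a
unification has identified `x` with another variable, then that variable stands for `x`. -/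
def RewHasAt (T : TBox NC NR) (q : UCQ NC NR Δ) (x : ℕ) (n : Node NC NR) : Prop :=
  x ∈ q.free ∧ ∃ r ∈ q.rew T, ∃ y, r.head x = .var y ∧ ∃ a ∈ r.body, a.HasAt (.var y) n

/-- Ordinary edges: a value may be copied. -/
def OrdinaryEdge (K : KAB NC NR FN Δ) (n₁ n₂ : Node NC NR) : Prop :=
  ∃ α ∈ K.actions, ∃ e ∈ α.effects, ∃ x, RewHasAt K.tbox e.pos x n₁ ∧
    ∃ φ ∈ e.head, φ.HasAt (.var x) n₂

/-- Special edges: a value may be used as an argument of a service call. -/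
def SpecialEdge (K : KAB NC NR FN Δ) (n₁ n₂ : Node NC NR) : Prop :=
  ∃ α ∈ K.actions, ∃ e ∈ α.effects, ∃ x, RewHasAt K.tbox e.pos x n₁ ∧
    ∃ φ ∈ e.head, ∃ f xs, x ∈ xs ∧ φ.HasAt (.call f xs) n₂

/-- No cycle of the dependency graph goes through a special edge. -/
def WeaklyAcyclic (K : KAB NC NR FN Δ) : Prop :=
  ∀ n₁ n₂, K.SpecialEdge n₁ n₂ →
    ¬ Relation.ReflTransGen (fun a b => K.OrdinaryEdge a b ∨ K.SpecialEdge a b) n₂ n₁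

end KAB

end KABs

/-! A query can only return values that it mentions or that already sit in the ABox, and the
positions where such a value sits are the ones the perfect rewriting names. If (T,A) is consistent
and a UCQ has a certain answer, then the query is true in the canonical model of (T,A), whose
elements are individuals and a forest of anonymous witnesses. Undoing the derivations of the matched
facts, one inclusion at a time, is exactly what the rewriting does. The process ends in a
reformulation matched in A itself. Hence the value of a free variable x is a constant of the query,
or it occurs in A at a position where x occurs in the rewriting, that is, at the source of an edge
of the dependency graph (`UCQ.Certain.mem_consts_or_occursAt`). Consistency is indispensable: over
an inconsistent ABox everything is an answer.

Along a run, results of service calls never change, so all the partial maps extend to one total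
function M. Let G(k) be the set of values obtained from a fixed finite set of constants by at most k
rounds of calls. The invariant (`KAB.Advance.specialPath`) says that a value outside G(k) occurs
only at positions reached by a path with k special edges. Copying a value uses an ordinary edge. A
call whose result is outside G(k+1) has an argument outside G(k) and uses a special edge. By weak
acyclicity the targets of the special edges on a path are distinct, so their number is at most some
k₀, and every value at a position of the graph lies in G(k₀+1). The size of this set has a bound
independent of M, hence of the run.

Repairs only delete facts, or add facts with the names `State` and `Viol` about finitely many fixed
constants. These names are not nodes of the graph, so the argument is unaffected. The five systems
then differ only in why actions are always executed in consistent ABoxes. For the certain repair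
this requires some maximal consistent subset to exist, which follows from the finiteness of
reachable ABoxes. -/

namespace KABs

/-! ### The canonical model of a consistent knowledge base -/

section Chase

variable {NC NR Δ τ : Type u}

/-! ### Facts for role expressions and basic concepts -/

/-- The fact `P(t,t')` if `R = P`, and `P(t',t)` if `R = P⁻`. -/
def Role.fact (R : Role NR) (t t' : τ) : Fact NC NR τ :=
  match R with
  | .name P => .role P t t'
  | .inv P => .role P t' t

/-- The fact `N(t)` if `B = N`, and the fact `R(t,z)` if `B = ∃R`. -/
def BasicConcept.fact (B : BasicConcept NC NR) (t z : τ) : Fact NC NR τ :=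
  match B with
  | .name N => .concept N t
  | .ex R => R.fact t z

theorem Role.inverse_inverse (R : Role NR) : R.inverse.inverse = R := by
  cases R <;> rfl

theorem Role.fact_inverse (R : Role NR) (t t' : τ) :
    (R.inverse.fact t t' : Fact NC NR τ) = R.fact t' t := by
  cases R <;> rfl

theorem Role.atom_eq_fact (R : Role NR) (t t' : Term Δ) :
    (R.atom t t' : Atom NC NR Δ) = R.fact t t' := by
  cases R <;> rfl

theorem BasicConcept.atom_eq_fact (B : BasicConcept NC NR) (t z : Term Δ) :
    B.atom t z = B.fact t z := by
  rcases B with _ | _ | _ <;> rfl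

theorem Role.mem_args_fact (R : Role NR) (t t' c : τ) :
    c ∈ (R.fact t t' : Fact NC NR τ).args ↔ c = t ∨ c = t' := by
  cases R <;> simp [Role.fact, Fact.args, or_comm]

theorem BasicConcept.mem_args_fact (B : BasicConcept NC NR) (t z : τ) :
    t ∈ (B.fact t z).args := by
  rcases B with _ | _ | _ <;> simp [BasicConcept.fact, Role.fact, Fact.args]

theorem BasicConcept.eq_or_eq_of_mem_args_fact {B : BasicConcept NC NR} {t z c : τ}
    (h : c ∈ (B.fact t z).args) : c = t ∨ c = z := by
  rcases B with _ | _ | _ <;>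
    simp only [BasicConcept.fact, Role.fact, Fact.args, List.mem_cons, List.not_mem_nil,
      or_false] at h <;> tauto

theorem Role.map_fact {NC' τ' : Type u} (g : NC → NC') (h : τ → τ') (R : Role NR) (t t' : τ) :
    (R.fact t t' : Fact NC NR τ).map g h = R.fact (h t) (h t') := by
  cases R <;> rfl

theorem BasicConcept.map_fact {τ' : Type u} (h : τ → τ') (B : BasicConcept NC NR) (t z : τ) :
    (B.fact t z).map id h = B.fact (h t) (h z) := by
  rcases B with _ | _ | _ <;> rfl

theorem Fact.args_map {NC' τ' : Type u} (g : NC → NC') (h : τ → τ') (φ : Fact NC NR τ) :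
    (φ.map g h).args = φ.args.map h := by
  cases φ <;> rfl

theorem Fact.map_map {NC' NC'' τ' τ'' : Type u} (g : NC → NC') (h : τ → τ') (g' : NC' → NC'')
    (h' : τ' → τ'') (φ : Fact NC NR τ) :
    (φ.map g h).map g' h' = φ.map (g' ∘ g) (h' ∘ h) := by
  cases φ <;> rfl

theorem Fact.map_congr {NC' τ' : Type u} {g : NC → NC'} {h h' : τ → τ'} {φ : Fact NC NR τ}
    (H : ∀ t ∈ φ.args, h t = h' t) : φ.map g h = φ.map g h' := by
  cases φ <;> simp_all [Fact.map, Fact.args]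

/-- A role fact is the instance of two role expressions: one in each direction. -/
theorem Role.fact_eq_fact {P R : Role NR} {a b c d : τ}
    (h : (P.fact a b : Fact NC NR τ) = R.fact c d) :
    (P = R ∧ a = c ∧ b = d) ∨ (P = R.inverse ∧ a = d ∧ b = c) := by
  cases P <;> cases R <;> simp_all [Role.fact, Role.inverse]

/-! ### The canonical model -/

/-- The role hierarchy: the reflexive and transitive closure of the role inclusions and of their
inverses. -/
def SubRole (T : TBox NC NR) : Role NR → Role NR → Prop :=
  Relation.ReflTransGen fun R S => Assertion.roleIncl R S ∈ T.assertions ∨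
    Assertion.roleIncl R.inverse S.inverse ∈ T.assertions

/-- A nontrivial chain would end with an inclusion into `S` or into its inverse, and neither may be
specialized. -/
theorem SubRole.eq_of_funct {T : TBox NC NR} {R S : Role NR}
    (hS : Assertion.funct S ∈ T.assertions) (h : SubRole T R S) : R = S := by
  rcases Relation.ReflTransGen.cases_tail h with h | ⟨Q, -, h | h⟩
  · exact h.symm
  · exact absurd rfl (T.funct_not_specialized S hS _ _ h).1
  · exact absurd rfl (T.funct_not_specialized S hS _ _ h).2

/-- The elements of the canonical model: individuals and anonymous witnesses; `wit u R` is the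
witness for `u ∈ ∃R`. -/
inductive Elem (NR Δ : Type u) : Type u
  | ind (c : Δ)
  | wit (u : Elem NR Δ) (R : Role NR)

/-- The distance of an element from the individuals. -/
def Elem.depth : Elem NR Δ → ℕ
  | .ind _ => 0
  | .wit u _ => u.depth + 1

theorem Elem.ne_wit (u : Elem NR Δ) (R : Role NR) : u ≠ .wit u R := fun h => by
  have := congrArg Elem.depth h
  simp [Elem.depth] at this

/-- The element has an `R`-successor that is not one of its own witnesses. -/
def HasSucc (T : TBox NC NR) (A : ABox NC NR Δ) : Elem NR Δ → Role NR → Prop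
  | .ind c, R => ∃ c' R₀, SubRole T R₀ R ∧ R₀.fact c c' ∈ A
  -- A witness was created by an `R'`-edge from its parent. Read backwards, this edge makes the
  -- parent an `R`-successor.
  | .wit _ R', R => SubRole T R' R.inverse

/-- The facts of the canonical model, with the heights of their derivations. -/
inductive Chase (T : TBox NC NR) (A : ABox NC NR Δ) : ℕ → Fact NC NR (Elem NR Δ) → Prop
  | base (φ : Fact NC NR Δ) : φ.map ConceptName.base id ∈ A → Chase T A 0 (φ.map id .ind)
  | name (n : ℕ) (B : BasicConcept NC NR) (N : NC) (u z : Elem NR Δ) :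
      Assertion.conceptIncl B (.name N) ∈ T.assertions → Chase T A n (B.fact u z) →
      Chase T A (n + 1) (.concept N u)
  | role (n : ℕ) (R S : Role NR) (u u' : Elem NR Δ) :
      Assertion.roleIncl R S ∈ T.assertions → Chase T A n (R.fact u u') →
      Chase T A (n + 1) (S.fact u u')
  -- The side condition refers to the ABox and the shape of `u`, not to facts derived so far. Thus
  -- the chase does not depend on an order of rule applications and can be an inductive predicate.
  | ex (n : ℕ) (B : BasicConcept NC NR) (R : Role NR) (u z : Elem NR Δ) :
      Assertion.conceptIncl B (.ex R) ∈ T.assertions → Chase T A n (B.fact u z) →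
      ¬ HasSucc T A u R → Chase T A (n + 1) (R.fact u (.wit u R))

/-- `φ` is true in the canonical model. -/
def Derivable (T : TBox NC NR) (A : ABox NC NR Δ) (φ : Fact NC NR (Elem NR Δ)) : Prop :=
  ∃ n, Chase T A n φ

/-- The canonical model. The extensions of the fresh names are irrelevant. -/
def chaseInterp (T : TBox NC NR) (A : ABox NC NR Δ) : Interp NC NR Δ (Elem NR Δ) where
  conc
    | .base N => {u | Derivable T A (.concept N u)}
    | .state => Set.univ
    | .viol => Set.univ
  role P a b := Derivable T A (.role P a b)
  const := .ind
  const_injective _ _ h := Elem.ind.inj h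

variable {T : TBox NC NR} {A : ABox NC NR Δ}

theorem chaseInterp_roleExt (R : Role NR) (a b : Elem NR Δ) :
    (chaseInterp T A).roleExt R a b ↔ Derivable T A (R.fact a b) := by
  cases R <;> rfl

theorem chaseInterp_conceptExt (B : BasicConcept NC NR) (a : Elem NR Δ) :
    a ∈ (chaseInterp T A).conceptExt B ↔ ∃ z, Derivable T A (B.fact a z) := by
  rcases B with N | R
  · exact ⟨fun h => ⟨a, h⟩, fun ⟨_, h⟩ => h⟩
  · exact exists_congr fun b => chaseInterp_roleExt R a b

theorem Derivable.of_subRole {R S : Role NR} {u u' : Elem NR Δ} (h : SubRole T R S)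
    (hR : Derivable T A (R.fact u u')) : Derivable T A (S.fact u u') := by
  induction h with
  | refl => exact hR
  | tail _ h ih =>
    obtain ⟨n, hn⟩ := ih
    rcases h with h | h
    · exact ⟨n + 1, .role n _ _ _ _ h hn⟩
    · rw [← Role.fact_inverse] at hn ⊢
      exact ⟨n + 1, .role n _ _ _ _ h hn⟩

/-- A witness occurs in the canonical model only together with its generating fact. -/
theorem Chase.derivable_wit {n : ℕ} {φ : Fact NC NR (Elem NR Δ)} (h : Chase T A n φ) :
    ∀ u R, Elem.wit u R ∈ φ.args → Derivable T A (R.fact u (.wit u R)) := by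
  induction h with
  | base φ h =>
    intro u R hm
    simp [Fact.args_map] at hm
  | name n B N u z hi h ih =>
    intro u' R hm
    simp only [Fact.args, List.mem_singleton] at hm
    exact ih _ _ (hm ▸ B.mem_args_fact _ _)
  | role n R S u u' hi h ih =>
    intro u' R hm
    rw [Role.mem_args_fact] at hm
    exact ih _ _ ((Role.mem_args_fact _ _ _ _).2 hm)
  | ex n B R u z hi h hs ih =>
    intro u' R' hm
    rw [Role.mem_args_fact] at hm
    rcases hm with hm | hm
    · exact ih _ _ (hm ▸ B.mem_args_fact _ _)
    · cases hm
      exact ⟨n + 1, .ex n B _ _ z hi h hs⟩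

/-- The role facts of the canonical model: they hold between individuals, or connect an element with
one of its own witnesses. -/
theorem Chase.role_cases {n : ℕ} {φ : Fact NC NR (Elem NR Δ)} (h : Chase T A n φ) :
    ∀ (R : Role NR) (u a : Elem NR Δ), φ = R.fact u a →
      (∃ c c' R₀, u = .ind c ∧ a = .ind c' ∧ SubRole T R₀ R ∧ R₀.fact c c' ∈ A) ∨
      (∃ R₀, a = .wit u R₀ ∧ SubRole T R₀ R ∧ ¬ HasSucc T A u R₀) ∨
      (∃ R₀, u = .wit a R₀ ∧ SubRole T R₀ R.inverse ∧ ¬ HasSucc T A a R₀) := by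
  induction h with
  | base φ h =>
    intro R u a he
    left
    cases φ with
    | concept N t => cases R <;> cases he
    | role P t t' =>
      cases R <;> cases he
      · exact ⟨t, t', .name P, rfl, rfl, .refl, h⟩
      · exact ⟨t', t, .inv P, rfl, rfl, .refl, h⟩
  | name n B N u z hi h ih =>
    intro R u a he
    cases R <;> cases he
  | role n R S u u' hi h ih =>
    intro R' v a he
    rcases Role.fact_eq_fact he with ⟨rfl, rfl, rfl⟩ | ⟨rfl, rfl, rfl⟩
    · rcases ih R u u' rfl with ⟨c, c', R₀, h1, h2, h3, h4⟩ | ⟨R₀, h1, h2, h3⟩ | ⟨R₀, h1, h2, h3⟩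
      · exact .inl ⟨c, c', R₀, h1, h2, h3.tail (.inl hi), h4⟩
      · exact .inr (.inl ⟨R₀, h1, h2.tail (.inl hi), h3⟩)
      · exact .inr (.inr ⟨R₀, h1, h2.tail (.inr (by simpa [Role.inverse_inverse] using hi)), h3⟩)
    · rcases ih R.inverse u' u (Role.fact_inverse _ _ _).symm with
        ⟨c, c', R₀, h1, h2, h3, h4⟩ | ⟨R₀, h1, h2, h3⟩ | ⟨R₀, h1, h2, h3⟩
      · exact .inl ⟨c, c', R₀, h1, h2,
          h3.tail (.inr (by simpa [Role.inverse_inverse] using hi)), h4⟩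
      · exact .inr (.inl ⟨R₀, h1, h2.tail (.inr (by simpa [Role.inverse_inverse] using hi)), h3⟩)
      · rw [Role.inverse_inverse] at h2
        exact .inr (.inr ⟨R₀, h1, h2.tail (.inl hi), h3⟩)
  | ex n B R u z hi h hs ih =>
    intro R' v a he
    rcases Role.fact_eq_fact he with ⟨rfl, rfl, rfl⟩ | ⟨rfl, rfl, rfl⟩
    · exact .inr (.inl ⟨R, rfl, .refl, hs⟩)
    · exact .inr (.inr ⟨_, rfl, .refl, hs⟩)

open Classical in
/-- A homomorphism from the canonical model to a model `I`: each witness is mapped to some witness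
in `I`, if there is one. -/
noncomputable def Elem.hom {D : Type u} (I : Interp NC NR Δ D) : Elem NR Δ → D
  | .ind c => I.const c
  -- The last value is a mere default: for a witness that occurs in the canonical model, the
  -- inclusion that created it provides a successor in `I`.
  | .wit u R => if h : ∃ b, I.roleExt R (Elem.hom I u) b then h.choose else Elem.hom I u

theorem Interp.satAtom_role_fact {D : Type u} (I : Interp NC NR Δ D) (R : Role NR) (a b : D) :
    I.SatAtom (R.fact a b) ↔ I.roleExt R a b := by
  cases R <;> rfl

theorem Interp.mem_conceptExt_of_satAtom {D : Type u} (I : Interp NC NR Δ D)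
    (B : BasicConcept NC NR) (a b : D)
    (h : I.SatAtom ((B.fact a b).map ConceptName.base id)) : a ∈ I.conceptExt B := by
  rcases B with N | R
  · exact h
  · exact ⟨b, by cases R <;> exact h⟩

/-- The canonical model is universal: every rule of the chase is forced in every model. This carries
negative inclusions and functionality between individuals back from any model. -/
theorem Chase.satAtom_hom {D : Type u} {I : Interp NC NR Δ D} (hI : I.IsModel T A) {n : ℕ}
    {φ : Fact NC NR (Elem NR Δ)} (h : Chase T A n φ) :
    I.SatAtom (φ.map ConceptName.base (Elem.hom I)) := by
  have key : ∀ (B : BasicConcept NC NR) u z,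
      I.SatAtom ((B.fact u z).map ConceptName.base (Elem.hom I)) →
      Elem.hom I u ∈ I.conceptExt B := fun B u z h => by
    refine I.mem_conceptExt_of_satAtom B _ (Elem.hom I z) ?_
    rwa [← BasicConcept.map_fact, Fact.map_map]
  induction h with
  | base φ h => cases φ <;> exact hI.2 _ h
  | name n B N u z hi h ih => exact hI.1 _ hi _ (key _ _ _ ih)
  | role n R S u u' hi h ih =>
    rw [Role.map_fact, Interp.satAtom_role_fact] at ih ⊢
    exact hI.1 _ hi _ _ ih
  | ex n B R u z hi h hs ih =>
    have h1 : ∃ b, I.roleExt R (Elem.hom I u) b := hI.1 _ hi _ (key _ _ _ ih)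
    rw [Role.map_fact, Interp.satAtom_role_fact, Elem.hom, dif_pos h1]
    exact h1.choose_spec

theorem Derivable.roleExt_hom {D : Type u} {I : Interp NC NR Δ D} (hI : I.IsModel T A)
    {R : Role NR} {a b : Elem NR Δ} (h : Derivable T A (R.fact a b)) :
    I.roleExt R (Elem.hom I a) (Elem.hom I b) := by
  obtain ⟨n, h⟩ := h
  have := h.satAtom_hom hI
  rwa [Role.map_fact, Interp.satAtom_role_fact] at this

theorem Derivable.mem_conceptExt_hom {D : Type u} {I : Interp NC NR Δ D} (hI : I.IsModel T A)
    {B : BasicConcept NC NR} {a b : Elem NR Δ} (h : Derivable T A (B.fact a b)) :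
    Elem.hom I a ∈ I.conceptExt B := by
  obtain ⟨n, h⟩ := h
  refine I.mem_conceptExt_of_satAtom B _ (Elem.hom I b) ?_
  rw [← BasicConcept.map_fact, Fact.map_map]
  exact h.satAtom_hom hI

/-- The canonical model satisfies the functionality assertions. -/
theorem chaseInterp_funct (hA : Consistent T A) {R : Role NR}
    (hR : Assertion.funct R ∈ T.assertions) {a b c : Elem NR Δ}
    (hb : Derivable T A (R.fact a b)) (hc : Derivable T A (R.fact a c)) : b = c := by
  obtain ⟨D, I, hI⟩ := hA
  obtain ⟨n, hn⟩ := id hb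
  obtain ⟨m, hm⟩ := id hc
  -- Each successor of `a` is an ABox neighbour, a witness of `a`, or the parent of `a`. A
  -- functional role has no proper subroles, so a witness for it coexists with neither of the other
  -- two: the side condition would have blocked it. Two ABox neighbours agree by functionality in
  -- `I` and unique names.
  rcases hn.role_cases R a b rfl with
      ⟨d, d', R₀, rfl, rfl, h3, h4⟩ | ⟨R₀, rfl, h2, h3⟩ | ⟨R₀, rfl, h2, h3⟩ <;>
    rcases hm.role_cases R _ c rfl with
      ⟨e, e', S₀, h1', rfl, h3', h4'⟩ | ⟨S₀, rfl, h2', h3'⟩ | ⟨S₀, h1', h2', h3'⟩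
  · exact congrArg _ (I.const_injective (hI.1 _ hR _ _ _ (hb.roleExt_hom hI) (hc.roleExt_hom hI)))
  · cases h2'.eq_of_funct hR
    exact absurd ⟨d', R₀, h3, h4⟩ h3'
  · cases h1'
  · cases h2.eq_of_funct hR
    subst h1'
    exact absurd ⟨e', S₀, h3', h4'⟩ h3
  · rw [h2.eq_of_funct hR, h2'.eq_of_funct hR]
  · cases h2.eq_of_funct hR
    subst h1'
    exact absurd h2' h3
  · cases h1'
  · cases h2'.eq_of_funct hR
    exact absurd h2 h3'
  · cases h1'
    rfl

/-- The canonical model of a consistent knowledge base is a model. -/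
theorem chaseInterp_isModel (hA : Consistent T A) : (chaseInterp T A).IsModel T A := by
  obtain ⟨D, I, hI⟩ := id hA
  refine ⟨fun t ht => ?_, fun φ hφ => ?_⟩
  · cases t with
    | conceptIncl B₁ B₂ =>
      intro a ha
      obtain ⟨z, n, hn⟩ := (chaseInterp_conceptExt _ _).1 ha
      rcases B₂ with N | R
      · exact ⟨n + 1, .name n _ _ _ _ ht hn⟩
      -- If the rule is blocked, the successor that blocks it (an ABox neighbour or the parent)
      -- satisfies the inclusion.
      · by_cases hs : HasSucc T A a R
        · cases a with
          | ind c =>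
            obtain ⟨c', R₀, h1, h2⟩ := hs
            refine ⟨.ind c', (chaseInterp_roleExt _ _ _).2 (Derivable.of_subRole h1 ⟨0, ?_⟩)⟩
            rw [← Role.map_fact id Elem.ind]
            exact .base _ (by rwa [Role.map_fact])
          | wit u R' =>
            refine ⟨u, (chaseInterp_roleExt _ _ _).2 ?_⟩
            have h1 := hn.derivable_wit u R' (B₁.mem_args_fact _ _)
            rw [← Role.fact_inverse]
            exact Derivable.of_subRole hs h1
        · exact ⟨.wit a R, (chaseInterp_roleExt _ _ _).2 ⟨n + 1, .ex n _ _ _ _ ht hn hs⟩⟩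
    | roleIncl R₁ R₂ =>
      intro a b hab
      rw [chaseInterp_roleExt] at hab ⊢
      exact Derivable.of_subRole (.single (.inl ht)) hab
    | conceptDisj B₁ B₂ =>
      intro a h1 h2
      rw [chaseInterp_conceptExt] at h1 h2
      obtain ⟨z, h1⟩ := h1
      obtain ⟨z', h2⟩ := h2
      exact hI.1 _ ht _ (h1.mem_conceptExt_hom hI) (h2.mem_conceptExt_hom hI)
    | roleDisj R₁ R₂ =>
      intro a b h1 h2
      rw [chaseInterp_roleExt] at h1 h2
      exact hI.1 _ ht _ _ (h1.roleExt_hom hI) (h2.roleExt_hom hI)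
    | funct R =>
      intro a b c h1 h2
      rw [chaseInterp_roleExt] at h1 h2
      exact chaseInterp_funct hA ht h1 h2
  · rcases φ with ⟨N | _ | _, t⟩ | ⟨P, t, t'⟩
    · exact ⟨0, .base (.concept N t) hφ⟩
    · trivial
    · trivial
    · exact ⟨0, .base (.role P t t') hφ⟩

end Chase

/-! ### Pulling matches in the canonical model back to the ABox -/

section Completeness

variable {NC NR Δ D : Type u}

/-! ### Unification -/

theorem Term.eval_subst {k : Δ → D} {w w' : ℕ → D} {s : ℕ → Term Δ}
    (h : ∀ x, (s x).eval k w' = w x) (t : Term Δ) : (t.subst s).eval k w' = t.eval k w := by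
  cases t with
  | var x => exact h x
  | const c => rfl

theorem Term.subst_subst {s₁ s₂ s : ℕ → Term Δ} (h : ∀ x, (s₁ x).subst s₂ = s x) (t : Term Δ) :
    (t.subst s₁).subst s₂ = t.subst s := by
  cases t with
  | var x => exact h x
  | const c => rfl

/-- If `t` and `t'` have the same value under `w`, then they have a most general unifier, and
applying it does not change values under `w`. -/
theorem Term.exists_mgu {k : Δ → D} (hk : Function.Injective k) {w : ℕ → D} {C : Set Δ}
    {t t' : Term Δ} (h : t.eval k w = t'.eval k w) (hC : ∀ c, t = .const c → c ∈ C)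
    (hC' : ∀ c, t' = .const c → c ∈ C) :
    ∃ s : ℕ → Term Δ, t.subst s = t'.subst s ∧
      (∀ s' : ℕ → Term Δ, t.subst s' = t'.subst s' → ∀ x, s' x = (s x).subst s') ∧
      (∀ x, (s x).eval k w = w x) ∧ ∀ x c, s x = .const c → c ∈ C := by
  have key : ∀ (x : ℕ) (t' : Term Δ), w x = t'.eval k w → (∀ c, t' = .const c → c ∈ C) →
      ∃ s : ℕ → Term Δ, (Term.var x).subst s = t'.subst s ∧
        (∀ s' : ℕ → Term Δ, (Term.var x).subst s' = t'.subst s' → ∀ x, s' x = (s x).subst s') ∧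
        (∀ x, (s x).eval k w = w x) ∧ ∀ x c, s x = .const c → c ∈ C := by
    intro x t' h hC
    -- Bind `x` to `t'`. There are no function symbols, so no occurs check is needed; if `t'` is `x`
    -- itself, this is the identity.
    refine ⟨Function.update Term.var x t', ?_, fun s' hs' y => ?_, fun y => ?_, fun y c hy => ?_⟩
    · simp only [Term.subst, Function.update_self]
      cases t' with
      | const c => rfl
      | var y =>
        by_cases hxy : y = x
        · subst hxy; simp
        · simp [Function.update_of_ne hxy]
    · by_cases hxy : y = x
      · subst hxy
        rw [Function.update_self]
        exact hs'
      · simp [Function.update_of_ne hxy, Term.subst]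
    · by_cases hxy : y = x
      · subst hxy; simpa using h.symm
      · simp [Function.update_of_ne hxy, Term.eval]
    · by_cases hxy : y = x
      · subst hxy; exact hC c (by simpa using hy)
      · simp [Function.update_of_ne hxy] at hy
  cases t with
  | var x => exact key x t' h hC'
  | const c =>
    cases t' with
    | var x =>
      obtain ⟨s, h1, h2, h3⟩ := key x (.const c) h.symm hC
      exact ⟨s, h1.symm, fun s' hs' => h2 s' hs'.symm, h3⟩
    | const c' =>
      cases hk h
      exact ⟨Term.var, rfl, fun s' _ x => rfl, fun x => rfl, fun x c h => by cases h⟩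

/-- Two atoms with the same instance under `w` have a most general unifier, and applying it does not
change values under `w`. -/
theorem exists_isMGU {k : Δ → D} (hk : Function.Injective k) {w : ℕ → D} {C : Set Δ}
    {a b : Atom NC NR Δ} (h : a.map id (Term.eval k w) = b.map id (Term.eval k w))
    (ha : ∀ c, Term.const c ∈ a.args → c ∈ C) (hb : ∀ c, Term.const c ∈ b.args → c ∈ C) :
    ∃ s : ℕ → Term Δ, IsMGU s a b ∧ (∀ x, (s x).eval k w = w x) ∧
      ∀ x c, s x = .const c → c ∈ C := by
  cases a with
  | concept N t =>
    cases b with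
    | role P t₁ t₂ => cases h
    | concept N' t' =>
      simp only [Fact.map, id, Fact.concept.injEq] at h
      obtain ⟨rfl, h⟩ := h
      simp only [Fact.args, List.mem_singleton] at ha hb
      obtain ⟨s, h1, h2, h3, h4⟩ := Term.exists_mgu hk h (fun c hc => ha c hc.symm)
        (fun c hc => hb c hc.symm)
      refine ⟨s, ⟨by simp [substAtom, Fact.map, h1], fun s' hs' => ⟨s', h2 s' ?_⟩⟩, h3, h4⟩
      simpa [substAtom, Fact.map] using hs'
  | role P t₁ t₂ =>
    cases b with
    | concept N t => cases h
    | role P' t₁' t₂' =>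
      simp only [Fact.map, Fact.role.injEq] at h
      obtain ⟨rfl, he₁, he₂⟩ := h
      simp only [Fact.args, List.mem_cons, List.not_mem_nil, or_false] at ha hb
      obtain ⟨s, h1, h2, h3, h4⟩ := Term.exists_mgu hk he₁ (fun c hc => ha c (.inl hc.symm))
        (fun c hc => hb c (.inl hc.symm))
      have hC : ∀ (t : Term Δ), (∀ c, t = .const c → c ∈ C) →
          ∀ c, t.subst s = .const c → c ∈ C := by
        intro t ht c hc
        cases t with
        | var x => exact h4 x c hc
        | const d => exact ht c hc
      -- The second arguments are unified after applying `s`, which leaves their values under `w`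
      -- unchanged. The composition is most general because each unifier `s'` absorbs both factors.
      obtain ⟨s₂, g1, g2, g3, g4⟩ := Term.exists_mgu hk (w := w) (t := t₂.subst s)
        (t' := t₂'.subst s)
        (by rw [Term.eval_subst h3, Term.eval_subst h3, he₂])
        (hC _ fun c hc => ha c (.inr hc.symm)) (hC _ fun c hc => hb c (.inr hc.symm))
      have hs : ∀ t : Term Δ, t.subst (fun x => (s x).subst s₂) = (t.subst s).subst s₂ :=
        fun t => (Term.subst_subst (fun _ => rfl) t).symm
      refine ⟨fun x => (s x).subst s₂, ⟨?_, fun s' hs' => ⟨s', fun x => ?_⟩⟩, fun x => ?_,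
        fun x c hx => ?_⟩
      · simp [substAtom, Fact.map, hs, h1, g1]
      · simp only [substAtom, Fact.map, Fact.role.injEq, true_and] at hs'
        have e1 := h2 s' hs'.1
        have e2 := g2 s' (by
          rw [Term.subst_subst fun x => (e1 x).symm, Term.subst_subst fun x => (e1 x).symm, hs'.2])
        rw [Term.subst_subst fun x => (e2 x).symm, e1 x]
      · rw [Term.eval_subst g3, h3]
      · cases hsx : s x with
        | var y => exact g4 y c (by simpa [hsx, Term.subst] using hx)
        | const d => exact h4 x c (by simpa [hsx, Term.subst] using hx)

/-! ### Completeness of the perfect rewriting -/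

variable {T : TBox NC NR} {A : ABox NC NR Δ}

/-- The smallest height of a derivation. -/
noncomputable def rank (T : TBox NC NR) (A : ABox NC NR Δ) (φ : Fact NC NR (Elem NR Δ)) : ℕ :=
  sInf {n | Chase T A n φ}

theorem Chase.rank_le {n : ℕ} {φ : Fact NC NR (Elem NR Δ)} (h : Chase T A n φ) :
    rank T A φ ≤ n := Nat.sInf_le h

theorem Derivable.chase_rank {φ : Fact NC NR (Elem NR Δ)} (h : Derivable T A φ) :
    Chase T A (rank T A φ) φ := Nat.sInf_mem h

/-- The last step in a derivation of minimal height. -/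
theorem Derivable.last_step {φ : Fact NC NR (Elem NR Δ)} (h : Derivable T A φ) :
    (∃ ψ : Fact NC NR Δ, ψ.map ConceptName.base id ∈ A ∧ φ = ψ.map id .ind) ∨
    (∃ B N u z, Assertion.conceptIncl B (.name N) ∈ T.assertions ∧ φ = .concept N u ∧
      Derivable T A (B.fact u z) ∧ rank T A (B.fact u z) < rank T A φ) ∨
    (∃ R S u u', Assertion.roleIncl R S ∈ T.assertions ∧ φ = S.fact u u' ∧
      Derivable T A (R.fact u u') ∧ rank T A (R.fact u u' : Fact NC NR _) < rank T A φ) ∨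
    (∃ B R u z, Assertion.conceptIncl B (.ex R) ∈ T.assertions ∧ φ = R.fact u (.wit u R) ∧
      Derivable T A (B.fact u z) ∧ rank T A (B.fact u z) < rank T A φ) := by
  have h' := h.chase_rank
  clear h
  generalize hn : rank T A φ = n at h'
  cases h' with
  | base ψ hψ => exact .inl ⟨ψ, hψ, rfl⟩
  | name n B N u z hi h =>
    exact .inr (.inl ⟨B, N, u, z, hi, rfl, ⟨n, h⟩, Nat.lt_succ_of_le h.rank_le⟩)
  | role n R S u u' hi h =>
    exact .inr (.inr (.inl ⟨R, S, u, u', hi, rfl, ⟨n, h⟩, Nat.lt_succ_of_le h.rank_le⟩))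
  | ex n B R u z hi h hs =>
    exact .inr (.inr (.inr ⟨B, R, u, z, hi, rfl, ⟨n, h⟩, Nat.lt_succ_of_le h.rank_le⟩))

/-- The instance of an atom in the canonical model. -/
def Fact.inst (w : ℕ → Elem NR Δ) (a : Atom NC NR Δ) : Fact NC NR (Elem NR Δ) :=
  a.map id (Term.eval .ind w)

/-- `w` maps the query `q`, with body `S` and answer variables `F`, to the canonical model, and the
answer variables to the individuals given by `v`. Moreover, the constants of `q` are in `C`, and
its distinguished variables occur in its body. -/
structure IsMatch (T : TBox NC NR) (A : ABox NC NR Δ) (F : Finset ℕ) (v : ℕ → Δ) (C : Set Δ)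
    (q : CQ NC NR Δ) (S : Finset (Atom NC NR Δ)) (w : ℕ → Elem NR Δ) : Prop where
  body_eq : q.body = ↑S
  head_eval : ∀ x ∈ F, (q.head x).eval .ind w = .ind (v x)
  derivable : ∀ a ∈ S, Derivable T A (a.inst w)
  body_const : ∀ a ∈ S, ∀ c, Term.const c ∈ a.args → c ∈ C
  head_const : ∀ x ∈ F, ∀ c, q.head x = .const c → c ∈ C
  head_safe : ∀ x ∈ F, ∀ y, q.head x = .var y → ∃ a ∈ S, Term.var y ∈ a.args

/-- A measure of the derivations of the instances of the atoms. -/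
noncomputable def cost (T : TBox NC NR) (A : ABox NC NR Δ) (S : Finset (Atom NC NR Δ))
    (w : ℕ → Elem NR Δ) : ℕ := ∑ a ∈ S, (rank T A (a.inst w) + 1)

variable {F : Finset ℕ} {v : ℕ → Δ} {C : Set Δ} {q : CQ NC NR Δ} {S : Finset (Atom NC NR Δ)}
  {w : ℕ → Elem NR Δ}

theorem Fact.inst_congr {w w' : ℕ → Elem NR Δ} {a : Atom NC NR Δ}
    (h : ∀ y, Term.var y ∈ a.args → w y = w' y) : a.inst w = a.inst w' := by
  refine Fact.map_congr fun t ht => ?_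
  cases t with
  | var y => exact h y ht
  | const c => rfl

-- Since `z` is fresh, its value `e` disturbs no other instance. One summand of the cost is
-- exchanged for a smaller one, or lost altogether if `b` was already in the body.
open Classical in
theorem IsMatch.replace (h : IsMatch T A F v C q S w) {a b : Atom NC NR Δ} (ha : a ∈ S) {z : ℕ}
    (hz : q.Fresh F z) {e : Elem NR Δ}
    (hb : Derivable T A (b.inst (Function.update w z e)))
    (hr : rank T A (b.inst (Function.update w z e)) < rank T A (a.inst w))
    (hc : ∀ c, Term.const c ∈ b.args → Term.const c ∈ a.args)
    (hs : ∀ x ∈ F, ∀ y, q.head x = .var y → Term.var y ∈ a.args → Term.var y ∈ b.args) :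
    IsMatch T A F v C (q.replace a b) (insert b (S.erase a)) (Function.update w z e) ∧
      cost T A (insert b (S.erase a)) (Function.update w z e) < cost T A S w := by
  have hw : ∀ a ∈ S, a.inst (Function.update w z e) = a.inst w := fun a ha => by
    refine Fact.inst_congr fun y hy => Function.update_of_ne ?_ _ _
    rintro rfl
    exact hz.2 a (by rw [h.body_eq]; exact ha) hy
  refine ⟨⟨?_, fun x hx => ?_, fun a' ha' => ?_, fun a' ha' c hc' => ?_, h.head_const,
    fun x hx y hy => ?_⟩, ?_⟩
  · simp [CQ.replace, h.body_eq]
  · rw [← h.head_eval x hx]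
    have := hz.1 x hx
    change (q.head x).eval _ _ = _
    cases hq : q.head x with
    | const c => rfl
    | var y => exact Function.update_of_ne (fun h => this (by rw [hq, h])) _ _
  · rcases Finset.mem_insert.1 ha' with rfl | ha'
    · exact hb
    · rw [hw a' (Finset.mem_of_mem_erase ha')]
      exact h.derivable a' (Finset.mem_of_mem_erase ha')
  · rcases Finset.mem_insert.1 ha' with rfl | ha'
    · exact h.body_const a ha c (hc c hc')
    · exact h.body_const a' (Finset.mem_of_mem_erase ha') c hc'
  · obtain ⟨a', ha', hy'⟩ := h.head_safe x hx y hy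
    by_cases haa : a' = a
    · subst haa
      exact ⟨b, Finset.mem_insert_self _ _, hs x hx y hy hy'⟩
    · exact ⟨a', Finset.mem_insert_of_mem (Finset.mem_erase.2 ⟨haa, ha'⟩), hy'⟩
  · have h1 : cost T A (insert b (S.erase a)) (Function.update w z e) ≤
        (rank T A (b.inst (Function.update w z e)) + 1) +
          ∑ a ∈ S.erase a, (rank T A (a.inst (Function.update w z e)) + 1) := by
      unfold cost
      by_cases hbS : b ∈ S.erase a
      · rw [Finset.insert_eq_of_mem hbS]
        exact Nat.le_add_left _ _
      · rw [Finset.sum_insert hbS]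
    have h2 : cost T A S w = (rank T A (a.inst w) + 1) +
        ∑ a ∈ S.erase a, (rank T A (a.inst (Function.update w z e)) + 1) := by
      rw [cost, ← Finset.add_sum_erase S _ ha]
      congr 1
      exact Finset.sum_congr rfl fun a' ha' => by rw [hw a' (Finset.mem_of_mem_erase ha')]
    omega

-- The substitution preserves values under `w`, hence all instances, while `a` and `b` merge. A
-- summand disappears, and the `+ 1` in `cost` makes this a strict decrease even at rank zero.
open Classical in
theorem IsMatch.reduce (h : IsMatch T A F v C q S w) {a b : Atom NC NR Δ} (ha : a ∈ S)
    (hb : b ∈ S) (hab : a ≠ b) {s : ℕ → Term Δ} (hs : IsMGU s a b)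
    (hw : ∀ x, (s x).eval .ind w = w x) (hC : ∀ x c, s x = .const c → c ∈ C) :
    IsMatch T A F v C (q.subst s) (S.image (substAtom s)) w ∧
      cost T A (S.image (substAtom s)) w < cost T A S w := by
  have hinst : ∀ a : Atom NC NR Δ, (substAtom s a).inst w = a.inst w := fun a => by
    rw [Fact.inst, substAtom, Fact.map_map]
    exact Fact.map_congr fun t _ => Term.eval_subst hw t
  refine ⟨⟨?_, fun x hx => ?_, fun a' ha' => ?_, fun a' ha' c hc' => ?_, fun x hx c hc => ?_,
    fun x hx y hy => ?_⟩, ?_⟩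
  · simp [CQ.subst, h.body_eq]
  · rw [← h.head_eval x hx]
    exact Term.eval_subst hw _
  · obtain ⟨a, ha, rfl⟩ := Finset.mem_image.1 ha'
    rw [hinst]
    exact h.derivable a ha
  · obtain ⟨a, ha, rfl⟩ := Finset.mem_image.1 ha'
    rw [substAtom, Fact.args_map, List.mem_map] at hc'
    obtain ⟨t, ht, htc⟩ := hc'
    cases t with
    | var y => exact hC y c htc
    | const d => cases htc; exact h.body_const a ha c ht
  · change (q.head x).subst s = _ at hc
    cases hq : q.head x with
    | var y => rw [hq] at hc; exact hC y c hc
    | const d => rw [hq] at hc; cases hc; exact h.head_const x hx c hq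
  · change (q.head x).subst s = _ at hy
    cases hq : q.head x with
    | const d => rw [hq] at hy; cases hy
    | var z =>
      rw [hq] at hy
      obtain ⟨a, ha, hz⟩ := h.head_safe x hx z hq
      refine ⟨substAtom s a, Finset.mem_image_of_mem _ ha, ?_⟩
      rw [substAtom, Fact.args_map, List.mem_map]
      exact ⟨_, hz, hy⟩
  · have himg : S.image (substAtom s) = (S.erase b).image (substAtom s) := by
      refine Finset.Subset.antisymm (fun c hc => ?_)
        (Finset.image_subset_image (Finset.erase_subset _ _))
      obtain ⟨d, hd, rfl⟩ := Finset.mem_image.1 hc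
      by_cases hdb : d = b
      · subst hdb
        rw [← hs.1]
        exact Finset.mem_image_of_mem _ (Finset.mem_erase.2 ⟨hab, ha⟩)
      · exact Finset.mem_image_of_mem _ (Finset.mem_erase.2 ⟨hdb, hd⟩)
    have hsum : ∀ S : Finset (Atom NC NR Δ), cost T A (S.image (substAtom s)) w ≤ cost T A S w := by
      intro S
      induction S using Finset.induction_on with
      | empty => simp [cost]
      | insert c S hc ih =>
        have e : cost T A (insert c S) w = rank T A (c.inst w) + 1 + cost T A S w :=
          Finset.sum_insert hc
        rw [Finset.image_insert, e]
        by_cases hm : substAtom s c ∈ S.image (substAtom s)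
        · rw [Finset.insert_eq_of_mem hm]; omega
        · have e' : cost T A (insert (substAtom s c) (S.image (substAtom s))) w =
            rank T A ((substAtom s c).inst w) + 1 + cost T A (S.image (substAtom s)) w :=
            Finset.sum_insert hm
          rw [e', hinst]; omega
    have h2 : cost T A S w = (rank T A (b.inst w) + 1) + cost T A (S.erase b) w :=
      (Finset.add_sum_erase S _ hb).symm
    have := hsum (S.erase b)
    rw [← himg] at this
    omega

theorem IsMatch.exists_fresh (h : IsMatch T A F v C q S w) : ∃ z, q.Fresh F z := by
  classical
  let g : Term Δ → ℕ := fun t => match t with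
    | .var x => x
    | .const _ => 0
  obtain ⟨z, hz⟩ := Infinite.exists_notMem_finset
    ((F.image fun x => g (q.head x)) ∪ S.biUnion fun a => (a.args.map g).toFinset)
  simp only [Finset.mem_union, Finset.mem_image, Finset.mem_biUnion, List.mem_toFinset,
    List.mem_map, not_or, not_exists, not_and] at hz
  refine ⟨z, fun x hx he => hz.1 x hx (by rw [he]), fun a ha hm => ?_⟩
  rw [h.body_eq] at ha
  exact hz.2 a ha _ hm rfl

theorem Fact.exists_role_fact_of_inst {a : Atom NC NR Δ} {R : Role NR} {u u' : Elem NR Δ}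
    (h : a.inst w = R.fact u u') :
    ∃ t t' : Term Δ, a = R.fact t t' ∧ t.eval .ind w = u ∧ t'.eval .ind w = u' := by
  cases a with
  | concept N t => cases R <;> cases h
  | role P t t' =>
    cases R <;> simp only [Fact.inst, Fact.map, Role.fact, Fact.role.injEq] at h <;>
      obtain ⟨rfl, h1, h2⟩ := h
    · exact ⟨t, t', rfl, h1, h2⟩
    · exact ⟨t', t, rfl, h2, h1⟩

/-- The greatest depth of an element in the fact. -/
def Fact.depth : Fact NC NR (Elem NR Δ) → ℕ
  | .concept _ u => u.depth
  | .role _ u u' => max u.depth u'.depth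

theorem Role.depth_fact_wit (R : Role NR) (u : Elem NR Δ) :
    (R.fact u (.wit u R) : Fact NC NR _).depth = u.depth + 1 := by
  cases R <;> simp [Role.fact, Fact.depth, Elem.depth]

theorem Fact.depth_map_ind (ψ : Fact NC NR Δ) :
    (ψ.map id Elem.ind : Fact NC NR (Elem NR Δ)).depth = 0 := by
  cases ψ <;> rfl

theorem Term.eval_update_of_ne (t : Term Δ) {z : ℕ} (ht : t ≠ .var z) (e : Elem NR Δ) :
    t.eval Elem.ind (Function.update w z e) = t.eval .ind w := by
  cases t with
  | var y => exact Function.update_of_ne (fun h => ht (by rw [h])) _ _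
  | const c => rfl

/-- As long as some instance is not in the ABox, there is a rewriting step that reduces the cost. -/
theorem IsMatch.exists_step (h : IsMatch T A F v C q S w) :
    (∀ a ∈ S, ∃ ψ : Fact NC NR Δ, ψ.map ConceptName.base id ∈ A ∧ a.inst w = ψ.map id .ind) ∨
    ∃ q' S' w', RewStep T F q q' ∧ IsMatch T A F v C q' S' w' ∧ cost T A S' w' < cost T A S w := by
  classical
  have hbody : ∀ {a}, a ∈ S → a ∈ q.body := fun ha => by rw [h.body_eq]; exact ha
  obtain ⟨z, hz⟩ := h.exists_fresh
  have hne : ∀ {a}, a ∈ S → ∀ {t}, t ∈ a.args → t ≠ .var z := fun ha t ht he =>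
    hz.2 _ (hbody ha) (he ▸ ht)
  -- The order of the cases matters. An inclusion with `∃R` on the right applies only to an unbound
  -- variable. This is guaranteed once no instance comes from another inclusion and no two atoms
  -- share an instance.
  by_cases hN : ∃ a ∈ S, ∃ B N u e, Assertion.conceptIncl B (.name N) ∈ T.assertions ∧
      a.inst w = .concept N u ∧ Derivable T A (B.fact u e) ∧
      rank T A (B.fact u e) < rank T A (a.inst w)
  · obtain ⟨a, ha, B, N, u, e, hi, he, hd, hr⟩ := hN
    cases a with
    | role P t t' => cases he
    | concept N' t =>
      simp only [Fact.inst, Fact.map, Fact.concept.injEq, id] at he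
      obtain ⟨rfl, rfl⟩ := he
      have hinst : (B.atom t (.var z) : Atom NC NR Δ).inst (Function.update w z e) =
          B.fact (t.eval .ind w) e := by
        rw [BasicConcept.atom_eq_fact, Fact.inst, BasicConcept.map_fact,
          Term.eval_update_of_ne t (hne ha (by simp [Fact.args]))]
        simp [Term.eval]
      rw [← hinst] at hd hr
      refine .inr ⟨_, _, _, .conceptName q B N' t z hi (hbody ha) hz,
        h.replace ha hz hd hr (fun c hc => ?_) (fun x hx y hy hm => ?_)⟩
      · rw [BasicConcept.atom_eq_fact] at hc
        rcases BasicConcept.eq_or_eq_of_mem_args_fact hc with rfl | hc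
        · simp [Fact.args]
        · cases hc
      · rw [BasicConcept.atom_eq_fact]
        simp only [Fact.args, List.mem_singleton] at hm
        exact hm ▸ B.mem_args_fact _ _
  by_cases hR : ∃ a ∈ S, ∃ R₁ R₂ u u', Assertion.roleIncl R₁ R₂ ∈ T.assertions ∧
      a.inst w = R₂.fact u u' ∧ Derivable T A (R₁.fact u u') ∧
      rank T A (R₁.fact u u' : Fact NC NR _) < rank T A (a.inst w)
  · obtain ⟨a, ha, R₁, R₂, u, u', hi, he, hd, hr⟩ := hR
    obtain ⟨t, t', rfl, rfl, rfl⟩ := Fact.exists_role_fact_of_inst he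
    -- No new variable is introduced here; the trivial update `z ↦ w z` fits the step to the common
    -- form of a replacement.
    have hinst : (R₁.atom t t' : Atom NC NR Δ).inst (Function.update w z (w z)) =
        R₁.fact (t.eval .ind w) (t'.eval .ind w) := by
      rw [Function.update_eq_self, Role.atom_eq_fact, Fact.inst, Role.map_fact]
    rw [← hinst] at hd hr
    have hstep := RewStep.role (F := F) q R₁ R₂ t t' hi (by
      rw [Role.atom_eq_fact]; exact hbody ha)
    rw [Role.atom_eq_fact R₂] at hstep
    refine .inr ⟨_, _, _, hstep, h.replace ha hz hd hr (fun c hc => ?_)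
      (fun x hx y hy hm => ?_)⟩
    · rwa [Role.atom_eq_fact, Role.mem_args_fact] at *
    · rwa [Role.atom_eq_fact, Role.mem_args_fact, ← Role.mem_args_fact R₂]
  by_cases hU : ∃ a ∈ S, ∃ b ∈ S, a ≠ b ∧ a.inst w = b.inst w
  · obtain ⟨a, ha, b, hb, hab, he⟩ := hU
    obtain ⟨s, h1, h2, h3⟩ := exists_isMGU (fun _ _ h => Elem.ind.inj h) he (h.body_const a ha)
      (h.body_const b hb)
    exact .inr ⟨_, _, w, .reduce q a b s (hbody ha) (hbody hb) hab h1,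
      h.reduce ha hb hab h1 h2 h3⟩
  have hlast : ∀ a ∈ S,
      (∃ ψ : Fact NC NR Δ, ψ.map ConceptName.base id ∈ A ∧ a.inst w = ψ.map id .ind) ∨
      (∃ B R u e, Assertion.conceptIncl B (.ex R) ∈ T.assertions ∧
        a.inst w = R.fact u (.wit u R) ∧ Derivable T A (B.fact u e) ∧
        rank T A (B.fact u e) < rank T A (a.inst w)) := fun a ha => by
    rcases (h.derivable a ha).last_step with h1 | h1 | h1 | h1
    · exact .inl h1
    · exact absurd ⟨a, ha, h1⟩ hN
    · exact absurd ⟨a, ha, h1⟩ hR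
    · exact .inr h1
  by_cases hB : ∀ a ∈ S, ∃ ψ : Fact NC NR Δ, ψ.map ConceptName.base id ∈ A ∧
      a.inst w = ψ.map id .ind
  · exact .inl hB
  push Not at hB
  obtain ⟨a₀, ha₀, hna₀⟩ := hB
  -- Choose a deepest instance. Some instance is outside the ABox, so the deepest one contains a
  -- witness and is itself a generating fact.
  obtain ⟨a, ha, hmax⟩ := S.exists_max_image (fun a => (a.inst w).depth) ⟨a₀, ha₀⟩
  rcases hlast a₀ ha₀ with ⟨ψ, h1, h2⟩ | ⟨_, R', u', _, -, h2, -⟩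
  · exact absurd h2 (hna₀ ψ h1)
  rcases hlast a ha with ⟨ψ, -, h1⟩ | ⟨B, R, u, e, hi, he, hd, hr⟩
  · have := hmax a₀ ha₀
    rw [h1, h2, Role.depth_fact_wit, Fact.depth_map_ind] at this
    omega
  obtain ⟨t, t', rfl, rfl, ht'⟩ := Fact.exists_role_fact_of_inst he
  cases t' with
  | const c => cases ht'
  | var y =>
  replace ht' : w y = .wit (t.eval .ind w) R := ht'
  -- Another atom with `y` would have the same witness in its generating fact. If the witness is the
  -- parent there, the fact is deeper than the maximum; otherwise both atoms have the same instance,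
  -- which was excluded.
  have hy : ∀ b ∈ S, Term.var y ∈ b.args → b = R.fact t (.var y) := fun b hb hyb => by
    have hm : Elem.wit (t.eval .ind w) R ∈ (b.inst w).args := by
      rw [Fact.inst, Fact.args_map, List.mem_map]
      exact ⟨_, hyb, ht'⟩
    rcases hlast b hb with ⟨ψ, -, h1⟩ | ⟨-, R₀, u₀, -, -, h1, -⟩
    · rw [h1] at hm
      simp [Fact.args_map] at hm
    · rw [h1, Role.mem_args_fact] at hm
      rcases hm with rfl | hm
      · have := hmax b hb
        rw [h1, he, Role.depth_fact_wit, Role.depth_fact_wit, Elem.depth] at this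
        omega
      · cases hm
        by_contra hne
        exact hU ⟨b, hb, _, ha, hne, by rw [h1, he]⟩
  have hhead : ∀ x ∈ F, q.head x ≠ .var y := fun x hx hxy => by
    have := h.head_eval x hx
    rw [hxy] at this
    cases ht'.symm.trans this
  have hty : t ≠ .var y := fun hty => by
    subst hty
    exact Elem.ne_wit _ _ ht'
  have hunb : q.Unbound F y := by
    refine ⟨hhead, fun b hb b' hb' hyb hyb' => ?_, fun P hP => ?_⟩
    · rw [h.body_eq] at hb hb'
      rw [hy b hb hyb, hy b' hb' hyb']
    · rw [h.body_eq] at hP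
      have := hy _ hP (by simp [Fact.args])
      cases R <;> simp [Role.fact] at this <;> exact hty this.2.symm
  have hinst : (B.atom t (.var z) : Atom NC NR Δ).inst (Function.update w z e) =
      B.fact (t.eval .ind w) e := by
    rw [BasicConcept.atom_eq_fact, Fact.inst, BasicConcept.map_fact,
      Term.eval_update_of_ne t (hne ha ((Role.mem_args_fact _ _ _ _).2 (.inl rfl)))]
    simp [Term.eval]
  rw [← hinst] at hd hr
  have hstep := RewStep.existsRole (F := F) q B R t y z hi (by
    rw [Role.atom_eq_fact]; exact hbody ha) hunb hz
  rw [Role.atom_eq_fact] at hstep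
  refine .inr ⟨_, _, _, hstep, h.replace ha hz hd hr (fun c hc => ?_) (fun x hx y' hy' hm => ?_)⟩
  · rw [BasicConcept.atom_eq_fact] at hc
    rcases BasicConcept.eq_or_eq_of_mem_args_fact hc with rfl | hc
    · exact (Role.mem_args_fact _ _ _ _).2 (.inl rfl)
    · cases hc
  · rw [BasicConcept.atom_eq_fact]
    rcases (Role.mem_args_fact _ _ _ _).1 hm with hm | hm
    · exact hm ▸ B.mem_args_fact _ _
    · cases hm
      exact absurd hy' (hhead x hx)

/-- Completeness of the perfect rewriting: a query with a match in the canonical model has a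
reformulation with a match in the ABox. -/
theorem IsMatch.exists_rewriting (h : IsMatch T A F v C q S w) :
    ∃ q' S' w', q' ∈ rewCQ T F q ∧ IsMatch T A F v C q' S' w' ∧
      ∀ a ∈ S', ∃ ψ : Fact NC NR Δ, ψ.map ConceptName.base id ∈ A ∧
        a.inst w' = ψ.map id .ind := by
  generalize hn : cost T A S w = n
  induction n using Nat.strong_induction_on generalizing q S w with
  | _ n ih =>
    rcases h.exists_step with h1 | ⟨q', S', w', h1, h2, h3⟩
    · exact ⟨q, S, w, .refl, h, h1⟩
    · obtain ⟨q'', S'', w'', g1, g2⟩ := ih _ (hn ▸ h3) h2 rfl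
      exact ⟨q'', S'', w'', .head h1 g1, g2⟩

theorem Fact.exists_hasAt {τ : Type u} {t : τ} {a : Fact NC NR τ} (h : t ∈ a.args) :
    ∃ n, a.HasAt t n := by
  cases a with
  | concept N t' =>
    simp only [Fact.args, List.mem_singleton] at h
    subst h
    exact ⟨_, .concept N⟩
  | role P t₁ t₂ =>
    simp only [Fact.args, List.mem_cons, List.not_mem_nil, or_false] at h
    rcases h with rfl | rfl
    · exact ⟨_, .role₁ P _⟩
    · exact ⟨_, .role₂ P _⟩

theorem Fact.HasAt.map {τ τ' : Type u} {t : τ} {a : Fact NC NR τ} {n : Node NC NR}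
    (h : a.HasAt t n) (g : τ → τ') : (a.map id g).HasAt (g t) n := by
  cases h <;> constructor

theorem Fact.HasAt.mem_args {τ : Type u} {t : τ} {a : Fact NC NR τ} {n : Node NC NR}
    (h : a.HasAt t n) : t ∈ a.args := by
  cases h <;> simp [Fact.args]

theorem Fact.HasAt.exists_of_map {τ τ' : Type u} {c : τ'} {a : Fact NC NR τ} {n : Node NC NR}
    {g : τ → τ'} (h : (a.map id g).HasAt c n) : ∃ t, a.HasAt t n ∧ g t = c := by
  cases a with
  | concept N t => cases h; exact ⟨t, .concept N, rfl⟩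
  | role P t₁ t₂ =>
    cases h
    · exact ⟨t₁, .role₁ P _, rfl⟩
    · exact ⟨t₂, .role₂ P _, rfl⟩

/-- `c` occurs in the ABox at the position `n`. -/
def OccursAt (A : ABox NC NR Δ) (c : Δ) (n : Node NC NR) : Prop :=
  ∃ ψ : Fact NC NR Δ, ψ.map ConceptName.base id ∈ A ∧ ψ.HasAt c n

/-- The constants of a query. -/
def UCQ.consts (q : UCQ NC NR Δ) : Set Δ := {c | ∃ d ∈ q.disjuncts, ∃ a ∈ d, Term.const c ∈ a.args}

theorem Term.finite_const_mem (l : List (Term Δ)) : {c | Term.const c ∈ l}.Finite := by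
  refine Set.Finite.of_finite_image (f := Term.const) ?_ fun a _ b _ h => Term.const.inj h
  exact l.finite_toSet.subset (by rintro _ ⟨c, hc, rfl⟩; exact hc)

theorem UCQ.finite_consts (q : UCQ NC NR Δ) : q.consts.Finite := by
  have : q.consts = ⋃ d ∈ q.disjuncts, ⋃ a ∈ d, {c | Term.const c ∈ a.args} := by
    ext c; simp [UCQ.consts]
  rw [this]
  exact q.disjuncts.finite_toSet.biUnion fun d _ =>
    d.finite_toSet.biUnion fun a _ => Term.finite_const_mem _

/-- A value in an answer to a query is a constant of the query, or it occurs in the ABox at one of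
the positions at which the corresponding variable occurs in the perfect rewriting. -/
theorem UCQ.Certain.mem_consts_or_occursAt {q : UCQ NC NR Δ} {v : ℕ → Δ} (hA : Consistent T A)
    (h : q.Certain T A v) {x : ℕ} (hx : x ∈ q.free) :
    v x ∈ q.consts ∨ ∃ n, KAB.RewHasAt T q x n ∧ OccursAt A (v x) n := by
  -- Of all models, only the canonical one is needed; consistency makes it a model.
  obtain ⟨d, hd, w, hw, hsat⟩ := h _ _ (chaseInterp_isModel hA)
  have hm : IsMatch T A q.free v q.consts ⟨Term.var, {a | a ∈ d}⟩ d w := by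
    refine ⟨rfl, hw, fun a ha => ?_, fun a ha c hc => ⟨d, hd, a, ha, hc⟩,
      fun x _ c hc => (by cases hc), fun x hx y hy => ?_⟩
    · have := hsat a ha
      cases a <;> exact this
    · cases hy
      exact q.safe d hd x hx
  obtain ⟨r, S, w', hr, hm', hbase⟩ := hm.exists_rewriting
  have hev := hm'.head_eval x hx
  cases hq : r.head x with
  | const c =>
    rw [hq] at hev
    rw [← Elem.ind.inj hev]
    exact .inl (hm'.head_const x hx c hq)
  | var y =>
    rw [hq] at hev
    obtain ⟨a, ha, hy⟩ := hm'.head_safe x hx y hq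
    obtain ⟨n, hn⟩ := Fact.exists_hasAt hy
    obtain ⟨ψ, hψ, he⟩ := hbase a ha
    refine .inr ⟨n, ⟨hx, r, ⟨d, hd, hr⟩, y, hq, a, by rw [hm'.body_eq]; exact ha, hn⟩, ψ, hψ, ?_⟩
    have h1 : (a.inst w').HasAt (Elem.ind (v x)) n := hev ▸ hn.map (Term.eval Elem.ind w')
    rw [he] at h1
    obtain ⟨c, hc, hcv⟩ := h1.exists_of_map
    cases hcv
    exact hc

end Completeness

/-! ### Bounding the values of a run, and the five transition systems -/

section Values

variable {NC NR FN Δ : Type u}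

/-! ### Values generated by service calls -/

open Classical in
/-- The lists of length `n` over `S`. -/
noncomputable def listsOver (S : Finset Δ) : ℕ → Finset (List Δ)
  | 0 => {[]}
  | n + 1 => Finset.image₂ List.cons S (listsOver S n)

open Classical in
theorem mem_listsOver {S : Finset Δ} {l : List Δ} (h : ∀ c ∈ l, c ∈ S) :
    l ∈ listsOver S l.length := by
  induction l with
  | nil => simp [listsOver]
  | cons c l ih =>
    exact Finset.mem_image₂_of_mem (h c (by simp)) (ih fun d hd => h d (by simp [hd]))

open Classical in
theorem card_listsOver_le (S : Finset Δ) (n : ℕ) : (listsOver S n).card ≤ S.card ^ n := by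
  induction n with
  | zero => simp [listsOver]
  | succ n ih =>
    rw [pow_succ']
    exact (Finset.card_image₂_le _ _ _).trans (Nat.mul_le_mul_left _ ih)

open Classical in
/-- The values generated from `C` by at most `k` rounds of calls to the services in `L`, which are
given with their numbers of arguments; `M` gives the results of the calls. -/
noncomputable def generated (C : Finset Δ) (L : Finset (FN × ℕ)) (M : ServiceCall FN Δ → Δ) :
    ℕ → Finset Δ
  | 0 => C
  | k + 1 => generated C L M k ∪
      L.biUnion fun p => (listsOver (generated C L M k) p.2).image fun l => M ⟨p.1, l⟩

open Classical in
theorem subset_generated (C : Finset Δ) (L : Finset (FN × ℕ)) (M : ServiceCall FN Δ → Δ) (k : ℕ) :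
    C ⊆ generated C L M k := by
  induction k with
  | zero => exact subset_rfl
  | succ k ih => exact ih.trans Finset.subset_union_left

open Classical in
theorem call_mem_generated {C : Finset Δ} {L : Finset (FN × ℕ)} {M : ServiceCall FN Δ → Δ} {k : ℕ}
    {f : FN} {l : List Δ} (hf : (f, l.length) ∈ L) (hl : ∀ c ∈ l, c ∈ generated C L M k) :
    M ⟨f, l⟩ ∈ generated C L M (k + 1) :=
  Finset.mem_union_right _ <| Finset.mem_biUnion.2
    ⟨_, hf, Finset.mem_image.2 ⟨l, mem_listsOver hl, rfl⟩⟩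

open Classical in
/-- The number of generated values has a bound that does not depend on the results of the calls. -/
theorem exists_card_generated_le (C : Finset Δ) (L : Finset (FN × ℕ)) (k : ℕ) :
    ∃ b, ∀ M, (generated C L M k).card ≤ b := by
  induction k with
  | zero => exact ⟨C.card, fun M => le_rfl⟩
  | succ k ih =>
    obtain ⟨b, hb⟩ := ih
    -- A service with n arguments has at most `b ^ n` calls on the values at hand.
    refine ⟨b + ∑ p ∈ L, b ^ p.2, fun M => ?_⟩
    refine (Finset.card_union_le _ _).trans (add_le_add (hb M) ?_)
    refine Finset.card_biUnion_le.trans (Finset.sum_le_sum fun p _ => ?_)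
    exact Finset.card_image_le.trans
      ((card_listsOver_le _ _).trans (Nat.pow_le_pow_left (hb M) _))

/-! ### Paths in the dependency graph -/

/-- There is a path to the node with the given number of special edges. -/
inductive SpecialPath (K : KAB NC NR FN Δ) : ℕ → Node NC NR → Prop
  | zero (n : Node NC NR) : SpecialPath K 0 n
  | ordinary (k : ℕ) (n n' : Node NC NR) :
      SpecialPath K k n → K.OrdinaryEdge n n' → SpecialPath K k n'
  | special (k : ℕ) (n n' : Node NC NR) :
      SpecialPath K k n → K.SpecialEdge n n' → SpecialPath K (k + 1) n'

theorem finite_hasAt (φ : Fact NC NR (HeadTerm FN Δ)) :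
    {n : Node NC NR | ∃ t, φ.HasAt t n}.Finite := by
  cases φ with
  | concept N t =>
    refine (Set.finite_singleton (Node.concept N)).subset ?_
    rintro n ⟨_, h⟩
    cases h
    rfl
  | role P t t' =>
    refine (Set.toFinite {Node.role₁ P, Node.role₂ P}).subset ?_
    rintro n ⟨_, h⟩
    cases h <;> simp

theorem KAB.finite_special_targets (K : KAB NC NR FN Δ) :
    {n' | ∃ n, K.SpecialEdge n n'}.Finite := by
  refine (K.actions.finite_toSet.biUnion fun α _ => α.effects.finite_toSet.biUnion fun e _ =>
    e.head.finite_toSet.biUnion fun φ _ => finite_hasAt φ).subset ?_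
  rintro n' ⟨n, α, hα, e, he, x, -, φ, hφ, f, xs, -, h⟩
  simp only [Set.mem_iUnion]
  exact ⟨α, hα, e, he, φ, hφ, _, h⟩

/-- In a weakly acyclic KAB, the number of special edges of a path is bounded. -/
theorem KAB.WeaklyAcyclic.exists_specialPath_le {K : KAB NC NR FN Δ} (hK : K.WeaklyAcyclic) :
    ∃ b, ∀ k n, SpecialPath K k n → k ≤ b := by
  classical
  -- `S` collects the targets of the special edges of the path. They are distinct, and only finitely
  -- many nodes can be such targets.
  have key : ∀ k n, SpecialPath K k n → ∃ S : Finset (Node NC NR), S.card = k ∧ ∀ m ∈ S,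
      (∃ m', K.SpecialEdge m' m) ∧
      Relation.ReflTransGen (fun a b => K.OrdinaryEdge a b ∨ K.SpecialEdge a b) m n := by
    intro k n h
    induction h with
    | zero n => exact ⟨∅, rfl, by simp⟩
    | ordinary k n n' _ he ih =>
      obtain ⟨S, h1, h2⟩ := ih
      exact ⟨S, h1, fun m hm => ⟨(h2 m hm).1, (h2 m hm).2.tail (.inl he)⟩⟩
    | special k n n' _ he ih =>
      obtain ⟨S, h1, h2⟩ := ih
      -- A repeated target leads to `n`, and the new special edge closes a cycle.
      have hn : n' ∉ S := fun hn => hK n n' he (h2 n' hn).2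
      refine ⟨insert n' S, by rw [Finset.card_insert_of_notMem hn, h1], fun m hm => ?_⟩
      rcases Finset.mem_insert.1 hm with rfl | hm
      · exact ⟨⟨n, he⟩, .refl⟩
      · exact ⟨(h2 m hm).1, (h2 m hm).2.tail (.inr he)⟩
  refine ⟨K.finite_special_targets.toFinset.card, fun k n h => ?_⟩
  obtain ⟨S, rfl, hS⟩ := key k n h
  exact Finset.card_le_card fun m hm => K.finite_special_targets.mem_toFinset.2 (hS m hm).1

/-! ### Bounded runs -/

/-- The facts about constants in `L` with the fresh concept names. -/
def freshFacts (NC NR : Type u) (L : Set Δ) : ABox NC NR Δ :=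
  {φ | ∃ c ∈ L, φ = .concept .state c ∨ φ = .concept .viol c}

/-- The steps that occur in the transition systems, without the details of the repair: the execution
of an action in a consistent state, and the removal of facts, where facts with fresh concept
names about constants in `L` may be added. -/
inductive KAB.Advance (K : KAB NC NR FN Δ) (L : Set Δ) (s s' : KState NC NR FN Δ) : Prop
  | action (t : KState NC NR FN Δ) (α : Action NC NR FN Δ) (σ : ℕ → Δ) :
      Consistent K.tbox s.abox → α ∈ K.actions → K.Exec s α σ t → s'.scmap = t.scmap →
      s'.abox ⊆ t.abox ∪ freshFacts NC NR L → KAB.Advance K L s s'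
  | remove : s'.scmap = s.scmap → s'.abox ⊆ s.abox ∪ freshFacts NC NR L → KAB.Advance K L s s'

/-- Calls are deterministic along a run, so the growing partial maps can be glued into one function.
-/
theorem KAB.Exec.scmap_eq {K : KAB NC NR FN Δ} {s t : KState NC NR FN Δ} {α : Action NC NR FN Δ}
    {σ : ℕ → Δ} (h : K.Exec s α σ t) {c : ServiceCall FN Δ} {d : Δ} (hc : s.scmap c = some d) :
    t.scmap c = some d := by
  obtain ⟨-, θ, h1, -, h3, h4⟩ := h
  by_cases hm : c ∈ calls (doFacts K.tbox s.abox α σ)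
  · rw [h3 c hm, h1 c hm d hc]
  · rw [h4 c hm, hc]

theorem KAB.Advance.scmap_eq {K : KAB NC NR FN Δ} {L : Set Δ} {s s' : KState NC NR FN Δ}
    (h : K.Advance L s s') {c : ServiceCall FN Δ} {d : Δ} (hc : s.scmap c = some d) :
    s'.scmap c = some d := by
  cases h with
  | action t α σ _ _ h h' _ => rw [h', h.scmap_eq hc]
  | remove h' _ => rw [h', hc]

theorem Fact.map_base_injective :
    Function.Injective fun φ : Fact NC NR Δ => (φ.map ConceptName.base id :
      Fact (ConceptName NC) NR Δ) := by
  intro φ ψ h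
  cases φ <;> cases ψ <;> simp_all [Fact.map]

theorem map_base_notMem_freshFacts {L : Set Δ} (φ : Fact NC NR Δ) :
    φ.map ConceptName.base id ∉ freshFacts NC NR L := by
  rintro ⟨c, -, h | h⟩ <;> cases φ <;> cases h

/-- Facts with the names `State` and `Viol` occupy no position of the dependency graph, so what a
repair adds is invisible to the invariant. -/
theorem OccursAt.mono {A A' : ABox NC NR Δ} {L : Set Δ} {c : Δ} {n : Node NC NR}
    (h : OccursAt A' c n) (hA : A' ⊆ A ∪ freshFacts NC NR L) : OccursAt A c n := by
  obtain ⟨ψ, hψ, hc⟩ := h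
  exact ⟨ψ, (hA hψ).resolve_right (map_base_notMem_freshFacts ψ), hc⟩

theorem finite_args {τ : Type u} (φ : Fact NC NR τ) : {c | c ∈ φ.args}.Finite :=
  φ.args.finite_toSet

/-- The individuals of the initial ABox and the constants of the queries in effects. -/
def KAB.consts (K : KAB NC NR FN Δ) : Set Δ :=
  {c | ∃ ψ ∈ K.abox₀, c ∈ ψ.args} ∪ {c | ∃ α ∈ K.actions, ∃ e ∈ α.effects, c ∈ e.pos.consts}

theorem KAB.finite_consts (K : KAB NC NR FN Δ) : K.consts.Finite := by
  refine Set.Finite.union ?_ ?_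
  · refine (K.abox₀.finite_toSet.biUnion fun ψ _ => finite_args ψ).subset ?_
    rintro c ⟨ψ, hψ, hc⟩
    exact Set.mem_biUnion hψ hc
  · refine (K.actions.finite_toSet.biUnion fun α _ => α.effects.finite_toSet.biUnion
      fun e _ => e.pos.finite_consts).subset ?_
    rintro c ⟨α, hα, e, he, hc⟩
    exact Set.mem_biUnion hα (Set.mem_biUnion he hc)

/-- The services called in effects, with their numbers of arguments. -/
def KAB.services (K : KAB NC NR FN Δ) : Set (FN × ℕ) :=
  {p | ∃ α ∈ K.actions, ∃ e ∈ α.effects, ∃ φ ∈ e.head, ∃ f xs, HeadTerm.call f xs ∈ φ.args ∧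
    p = (f, xs.length)}

theorem KAB.finite_services (K : KAB NC NR FN Δ) : K.services.Finite := by
  have hfin : ∀ φ : Fact NC NR (HeadTerm FN Δ),
      {p : FN × ℕ | ∃ f xs, HeadTerm.call f xs ∈ φ.args ∧ p = (f, xs.length)}.Finite := by
    intro φ
    let g : HeadTerm FN Δ → Set (FN × ℕ) := fun t => match t with
      | .call f xs => {(f, xs.length)}
      | _ => ∅
    refine ((finite_args φ).biUnion (t := g) fun t _ => ?_).subset ?_
    · cases t <;> exact Set.toFinite _
    · rintro p ⟨f, xs, h, rfl⟩
      exact Set.mem_biUnion h rfl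
  refine (K.actions.finite_toSet.biUnion fun α _ => α.effects.finite_toSet.biUnion fun e _ =>
    e.head.finite_toSet.biUnion fun φ _ => hfin φ).subset ?_
  rintro p ⟨α, hα, e, he, φ, hφ, h⟩
  exact Set.mem_biUnion hα (Set.mem_biUnion he (Set.mem_biUnion hφ h))

/-- A value that is not generated by `k` rounds of service calls occurs only at positions with an
incoming path with `k` special edges. This property is preserved by all steps. -/
theorem KAB.Advance.specialPath {K : KAB NC NR FN Δ} {L : Set Δ} {s s' : KState NC NR FN Δ}
    (h : K.Advance L s s') {C : Finset Δ} (hC : K.consts ⊆ ↑C) {F : Finset (FN × ℕ)}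
    (hF : K.services ⊆ ↑F) {M : ServiceCall FN Δ → Δ}
    (hM : ∀ c d, s'.scmap c = some d → M c = d)
    (ih : ∀ c n, OccursAt s.abox c n → ∀ k, c ∉ generated C F M k → SpecialPath K k n)
    (c : Δ) (n : Node NC NR) (hc : OccursAt s'.abox c n) (k : ℕ)
    (hk : c ∉ generated C F M k) : SpecialPath K k n := by
  cases h with
  | remove _ hA => exact ih c n (hc.mono hA) k hk
  | action t α σ hcons hα hex hsc hA =>
    obtain ⟨ψ, hψ, hψc⟩ := hc.mono hA
    obtain ⟨-, θ, -, h2, h3, -⟩ := hex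
    rw [h2] at hψ
    obtain ⟨φ, hφ, hφψ⟩ := hψ
    obtain ⟨e, he, v, -, hv, -, h, hh, rfl⟩ := id hφ
    have hψ' : ψ = h.map id (Sum.elim id θ ∘ HeadTerm.ground v) := by
      refine Fact.map_base_injective ?_
      simp only [← hφψ, Fact.map_map]
      rfl
    rw [hψ'] at hψc
    obtain ⟨t', ht', htc⟩ := hψc.exists_of_map
    have hCk : ∀ k, K.consts ⊆ ↑(generated C F M k) := fun k =>
      hC.trans (Finset.coe_subset.2 (subset_generated C F M k))
    -- The crucial link between queries and graph: an ungenerated value is no constant of the query,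
    -- so it was already in the old ABox, at a position that is the source of an edge for `x`. The
    -- negative part of the effect only filters answers and plays no role.
    have hval : ∀ k x, x ∈ t'.vars → v x ∉ generated C F M k →
        ∃ n', KAB.RewHasAt K.tbox e.pos x n' ∧ SpecialPath K k n' := by
      intro k x hx hk
      rcases UCQ.Certain.mem_consts_or_occursAt hcons hv.2
        (e.head_vars h hh t' ht'.mem_args x hx) with h1 | ⟨n', h1, h2⟩
      · exact absurd (hCk k (.inr ⟨α, hα, e, he, h1⟩)) hk
      · exact ⟨n', h1, ih _ _ h2 k hk⟩
    cases t' with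
    | const d =>
      cases htc
      exact absurd (hCk k (.inl (K.head_const α hα e he h hh d ht'.mem_args))) hk
    | var x =>
      cases htc
      obtain ⟨n', h1, h2⟩ := hval k x rfl hk
      exact .ordinary k n' n h2 ⟨α, hα, e, he, x, h1, h, hh, ht'⟩
    | call f xs =>
      cases k with
      | zero => exact .zero n
      | succ k =>
        have hcall : (⟨f, xs.map v⟩ : ServiceCall FN Δ) ∈ calls (doFacts K.tbox s.abox α σ) :=
          ⟨_, hφ, by
            rw [Fact.args_map]
            exact List.mem_map_of_mem (f := HeadTerm.ground v) ht'.mem_args⟩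
        have hMc : M ⟨f, xs.map v⟩ = c := hM _ _ (by rw [hsc, h3 _ hcall]; exact congrArg _ htc)
        -- Were all arguments available after `k` rounds, the result would be available after `k +
        -- 1`.
        have : ∃ x ∈ xs, v x ∉ generated C F M k := by
          by_contra! hall
          refine hk (hMc ▸ call_mem_generated (hF ?_) ?_)
          · exact ⟨α, hα, e, he, h, hh, f, xs, ht'.mem_args, by rw [List.length_map]⟩
          · simpa using hall
        obtain ⟨x, hx, hxk⟩ := this
        obtain ⟨n', h1, h2⟩ := hval k x hx hxk
        exact .special k n' n h2 ⟨α, hα, e, he, x, h1, h, hh, f, xs, hx, ht'⟩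

/-- The path invariant sees only the original vocabulary. The other constants of the active domain
are confined to `L` by this lemma. -/
theorem KAB.Advance.base_or_fresh {K : KAB NC NR FN Δ} {L : Set Δ} {s s' : KState NC NR FN Δ}
    (h : K.Advance L s s')
    (ih : ∀ φ ∈ s.abox, (∃ ψ : Fact NC NR Δ, φ = ψ.map ConceptName.base id) ∨
      φ ∈ freshFacts NC NR L) :
    ∀ φ ∈ s'.abox, (∃ ψ : Fact NC NR Δ, φ = ψ.map ConceptName.base id) ∨
      φ ∈ freshFacts NC NR L := by
  intro φ hφ
  cases h with
  | remove _ hA => exact (hA hφ).elim (ih φ) .inr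
  | action t α σ _ _ hex _ hA =>
    refine (hA hφ).elim (fun hφ => ?_) .inr
    obtain ⟨-, θ, -, h2, -⟩ := hex
    rw [h2] at hφ
    obtain ⟨ψ, -, rfl⟩ := hφ
    exact .inl ⟨ψ.map id (Sum.elim id θ), by rw [Fact.map_map]; rfl⟩

/-- In a weakly acyclic KAB, there is a bound for the number of values in sequences of steps. -/
theorem KAB.WeaklyAcyclic.exists_bound {K : KAB NC NR FN Δ} (hK : K.WeaklyAcyclic) {L : Set Δ}
    (hL : L.Finite) :
    ∃ b : ℕ, ∀ (s : ℕ → KState NC NR FN Δ) (len : ℕ∞), s 0 = K.initState →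
      (∀ i : ℕ, ((i + 1 : ℕ) : ℕ∞) ≤ len → K.Advance L (s i) (s (i + 1))) →
      (⋃ i ∈ {i : ℕ | (i : ℕ∞) ≤ len}, adom (s i).abox).encard < (b : ℕ∞) := by
  classical
  -- The total function `M` below needs a default value.
  by_cases hΔ : Nonempty Δ
  swap
  · refine ⟨1, fun s len _ _ => ?_⟩
    rw [not_nonempty_iff] at hΔ
    rw [Set.eq_empty_of_isEmpty (⋃ i ∈ {i : ℕ | (i : ℕ∞) ≤ len}, adom (s i).abox)]
    simp
  obtain ⟨C, hC⟩ := (K.finite_consts.union hL).exists_finset_coe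
  obtain ⟨F, hF⟩ := K.finite_services.exists_finset_coe
  obtain ⟨k, hk⟩ := hK.exists_specialPath_le
  -- One round more than the maximal number `k` of special edges: a value not generated by then
  -- would require a path with `k + 1` of them.
  obtain ⟨b, hb⟩ := exists_card_generated_le C F (k + 1)
  refine ⟨b + 1, fun s len h0 hstep => ?_⟩
  have hmono : ∀ {i j : ℕ}, i ≤ j → (j : ℕ∞) ≤ len → ∀ c d, (s i).scmap c = some d →
      (s j).scmap c = some d := by
    intro i j hij
    induction j, hij using Nat.le_induction with
    | base => exact fun _ c d h => h
    | succ j _ ih =>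
      exact fun hj c d h => (hstep j hj).scmap_eq
        (ih (le_trans (by exact_mod_cast Nat.le_succ j) hj) c d h)
  -- `M` takes the result from any state of the run that knows it; by monotonicity all such states
  -- agree.
  let M : ServiceCall FN Δ → Δ := fun c =>
    if h : ∃ d, ∃ i : ℕ, (i : ℕ∞) ≤ len ∧ (s i).scmap c = some d then h.choose
    else Classical.arbitrary Δ
  have hM : ∀ i : ℕ, (i : ℕ∞) ≤ len → ∀ c d, (s i).scmap c = some d → M c = d := by
    intro i hi c d hd
    have h : ∃ d, ∃ i : ℕ, (i : ℕ∞) ≤ len ∧ (s i).scmap c = some d := ⟨d, i, hi, hd⟩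
    have hMc : M c = h.choose := dif_pos h
    obtain ⟨j, hj, hjd⟩ := h.choose_spec
    rw [hMc]
    rcases le_total i j with hij | hij
    · exact Option.some.inj (hjd.symm.trans (hmono hij hj c d hd))
    · exact Option.some.inj ((hmono hij hi c _ hjd).symm.trans hd)
  have hpath : ∀ i : ℕ, (i : ℕ∞) ≤ len → ∀ c n, OccursAt (s i).abox c n →
      ∀ k, c ∉ generated C F M k → SpecialPath K k n := by
    intro i
    induction i with
    | zero =>
      intro _ c n hc k hk
      rw [h0] at hc
      obtain ⟨ψ, ⟨ψ', hψ', he⟩, hψ⟩ := hc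
      cases Fact.map_base_injective he
      refine absurd (subset_generated C F M k ?_) hk
      rw [← Finset.mem_coe, hC]
      exact .inl (.inl ⟨ψ, hψ', hψ.mem_args⟩)
    | succ i ih =>
      intro hi
      exact (hstep i hi).specialPath (by rw [hC]; exact Set.subset_union_left) hF.ge
        (hM (i + 1) hi) (ih (le_trans (by exact_mod_cast Nat.le_succ i) hi))
  have hfacts : ∀ i : ℕ, (i : ℕ∞) ≤ len → ∀ φ ∈ (s i).abox,
      (∃ ψ : Fact NC NR Δ, φ = ψ.map ConceptName.base id) ∨ φ ∈ freshFacts NC NR L := by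
    intro i
    induction i with
    | zero =>
      intro _ φ hφ
      rw [h0] at hφ
      obtain ⟨ψ, -, rfl⟩ := hφ
      exact .inl ⟨ψ, rfl⟩
    | succ i ih =>
      exact fun hi => (hstep i hi).base_or_fresh
        (ih (le_trans (by exact_mod_cast Nat.le_succ i) hi))
  have hsub : (⋃ i ∈ {i : ℕ | (i : ℕ∞) ≤ len}, adom (s i).abox) ⊆
      ↑(generated C F M (k + 1)) := by
    refine Set.iUnion₂_subset fun i hi c hc => ?_
    obtain ⟨φ, hφ, hcφ⟩ := hc
    rcases hfacts i hi φ hφ with ⟨ψ, rfl⟩ | ⟨d, hd, h⟩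
    · rw [Fact.args_map, List.map_id] at hcφ
      obtain ⟨n, hn⟩ := Fact.exists_hasAt hcφ
      by_contra hgen
      have := hk _ _ (hpath i hi c n ⟨ψ, hφ, hn⟩ (k + 1) hgen)
      omega
    · have hcd : c = d := by
        rcases h with rfl | rfl <;> simpa [Fact.args] using hcφ
      subst hcd
      refine subset_generated C F M (k + 1) ?_
      rw [← Finset.mem_coe, hC]
      exact .inr hd
  refine (Set.encard_le_encard hsub).trans_lt ?_
  rw [Set.encard_coe_eq_coe_finsetCard]
  exact_mod_cast Nat.lt_succ_of_le (hb M)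

/-! ### Consistency and repairs -/

theorem Consistent.mono {T : TBox NC NR} {A A' : ABox NC NR Δ} (h : Consistent T A)
    (hA : A' ⊆ A) : Consistent T A' := by
  obtain ⟨D, I, h1, h2⟩ := h
  exact ⟨D, I, h1, fun φ hφ => h2 φ (hA hφ)⟩

/-- Facts with fresh concept names have no influence on consistency. -/
theorem Consistent.union_fresh {T : TBox NC NR} {A E : ABox NC NR Δ} {L : Set Δ}
    (h : Consistent T A) (hE : E ⊆ freshFacts NC NR L) : Consistent T (A ∪ E) := by
  obtain ⟨D, I, h1, h2⟩ := h
  -- TBox assertions cannot mention the fresh names, so these may be reinterpreted as the whole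
  -- domain.
  let J : Interp NC NR Δ D :=
    { I with conc := fun N => match N with
        | .base N => I.conc (.base N)
        | .state => Set.univ
        | .viol => Set.univ }
  have hR : ∀ R, J.roleExt R = I.roleExt R := fun R => by cases R <;> rfl
  have hB : ∀ B, J.conceptExt B = I.conceptExt B := fun B => by
    rcases B with N | R
    · rfl
    · simp only [Interp.conceptExt, hR]
  refine ⟨D, J, fun t ht => ?_, ?_⟩
  · have := h1 t ht
    cases t <;> simpa only [Interp.SatAssertion, hR, hB] using this
  · rintro φ (hφ | hφ)
    · have := h2 φ hφ
      rcases φ with ⟨N | _ | _, t⟩ | _ <;> first | exact this | trivial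
    · obtain ⟨c, -, rfl | rfl⟩ := hE hφ <;> trivial

theorem consistent_empty (T : TBox NC NR) : Consistent T (∅ : ABox NC NR Δ) := by
  let I : Interp NC NR Δ Δ := ⟨fun _ => ∅, fun _ _ _ => False, id, Function.injective_id⟩
  have hR : ∀ R a b, ¬ I.roleExt R a b := fun R => by cases R <;> exact fun _ _ h => h
  have hB : ∀ B a, a ∉ I.conceptExt B := fun B a => by
    rcases B with N | R
    · exact fun h => h
    · exact fun ⟨b, h⟩ => hR R a b h
  refine ⟨Δ, I, fun t _ => ?_, fun φ h => h.elim⟩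
  cases t with
  | conceptIncl B₁ B₂ => exact fun a h => (hB _ _ h).elim
  | roleIncl R₁ R₂ => exact fun a b h => (hR _ _ _ h).elim
  | conceptDisj B₁ B₂ => exact fun a h => (hB _ _ h).elim
  | roleDisj R₁ R₂ => exact fun a b h => (hR _ _ _ h).elim
  | funct R => exact fun a b c h => (hR _ _ _ h).elim

/-- There are finitely many candidates, and the empty ABox is one of them. -/
theorem exists_isBoldRepair (T : TBox NC NR) {A : ABox NC NR Δ} (hA : A.Finite) :
    ∃ B, IsBoldRepair T A B := by
  have hfin : {B : ABox NC NR Δ | B ⊆ A ∧ Consistent T B}.Finite :=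
    hA.finite_subsets.subset fun B hB => hB.1
  obtain ⟨B, -, hB⟩ := hfin.exists_le_maximal (a := (∅ : ABox NC NR Δ))
    ⟨Set.empty_subset _, consistent_empty T⟩
  exact ⟨B, hB⟩

/-- The intersection lies inside any one bold repair. Finiteness supplies one; over an empty family
the intersection would be the set of all facts. -/
theorem IsCertainRepair.subset_and_consistent {T : TBox NC NR} {A A' : ABox NC NR Δ}
    (hA : A.Finite) (h : IsCertainRepair T A A') : A' ⊆ A ∧ Consistent T A' := by
  obtain ⟨B, hB⟩ := exists_isBoldRepair T hA
  have : A' ⊆ B := by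
    rw [IsCertainRepair] at h
    exact h ▸ Set.sInter_subset_of_mem hB
  exact ⟨this.trans hB.prop.1, hB.prop.2.mono this⟩

theorem finite_adom {A : ABox NC NR Δ} (hA : A.Finite) : (adom A).Finite := by
  refine (hA.biUnion fun φ _ => finite_args φ).subset ?_
  rintro c ⟨φ, hφ, hc⟩
  exact Set.mem_biUnion hφ hc

/-- The execution of an action in a finite ABox issues finitely many facts. -/
theorem KAB.finite_doFacts {A : ABox NC NR Δ} (hA : A.Finite) (T : TBox NC NR)
    (α : Action NC NR FN Δ) (σ : ℕ → Δ) : (doFacts T A α σ).Finite := by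
  classical
  have : Finite (adom A) := finite_adom hA
  -- Only the values of the free variables matter, and they lie in the finite active domain; `σ`
  -- fills the remaining places arbitrarily.
  let ext : (e : Effect NC NR FN Δ) → (e.pos.free → adom A) → ℕ → Δ := fun e g x =>
    if hx : x ∈ e.pos.free then g ⟨x, hx⟩ else σ x
  refine (α.effects.finite_toSet.biUnion fun e _ => e.head.finite_toSet.biUnion fun h _ =>
    Set.finite_range fun g : e.pos.free → adom A =>
      h.map id (HeadTerm.ground (ext e g))).subset ?_
  rintro φ ⟨e, he, v, -, hv, -, h, hh, rfl⟩
  refine Set.mem_biUnion he (Set.mem_biUnion hh ⟨fun x => ⟨v x, hv.1 x x.2⟩, ?_⟩)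
  refine Fact.map_congr fun t ht => ?_
  have hx : ∀ x ∈ t.vars, ext e (fun x => ⟨v x, hv.1 x x.2⟩) x = v x := fun x hx =>
    dif_pos (e.head_vars h hh t ht x hx)
  cases t with
  | const c => rfl
  | var x => exact congrArg _ (hx x rfl)
  | call f xs =>
    simp only [HeadTerm.ground, Sum.inr.injEq, ServiceCall.mk.injEq, true_and]
    exact List.map_congr_left hx

theorem KAB.Exec.finite_abox {K : KAB NC NR FN Δ} {s t : KState NC NR FN Δ}
    {α : Action NC NR FN Δ} {σ : ℕ → Δ} (h : K.Exec s α σ t) (hs : s.abox.Finite) :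
    t.abox.Finite := by
  obtain ⟨-, θ, -, h2, -⟩ := h
  rw [h2]
  exact (KAB.finite_doFacts hs _ _ _).image _

theorem KAB.finite_initState (K : KAB NC NR FN Δ) : K.initState.abox.Finite := by
  refine (K.abox₀.finite_toSet.image fun ψ => ψ.map ConceptName.base id).subset ?_
  rintro φ ⟨ψ, hψ, rfl⟩
  exact ⟨ψ, hψ, rfl⟩

/-! ### The transition systems -/

/-- If the steps from reachable states have the form considered above, then the generated transition
system is run-bounded. -/
theorem KAB.WeaklyAcyclic.generate_runBounded {K : KAB NC NR FN Δ} (hK : K.WeaklyAcyclic)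
    {L : Set Δ} (hL : L.Finite) {step : KState NC NR FN Δ → KState NC NR FN Δ → Prop}
    (hstep : ∀ s s', Relation.ReflTransGen step K.initState s → step s s' → K.Advance L s s') :
    (generate K.initState step).RunBounded := by
  obtain ⟨b, hb⟩ := hK.exists_bound hL
  exact ⟨b, fun s len hs => hb s len hs.1 fun i hi => hstep _ _ (hs.2 i hi).1 (hs.2 i hi).2⟩

/-- Every state other than the initial one was admitted because its ABox is consistent. -/
theorem KAB.WeaklyAcyclic.standardTS_runBounded {K : KAB NC NR FN Δ} (hK : K.WeaklyAcyclic) :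
    K.standardTS.RunBounded := by
  refine hK.generate_runBounded Set.finite_empty fun s s' hs hstep => ?_
  have hcons : Consistent K.tbox s.abox := by
    rcases Relation.ReflTransGen.cases_tail hs with h | ⟨t, -, α, -, σ, -, h⟩
    · rw [h]; exact K.consistent₀
    · exact h
  obtain ⟨α, hα, σ, hex, -⟩ := hstep
  exact .action s' α σ hcons hα hex rfl Set.subset_union_left

/-- The transition systems with repair steps are run-bounded, for any repairs that are consistent
subsets of the ABox. -/
theorem KAB.WeaklyAcyclic.repair_runBounded {K : KAB NC NR FN Δ} (hK : K.WeaklyAcyclic)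
    (temp : Δ) {L : Set Δ} (hL : L.Finite) {rep : ABox NC NR Δ → ABox NC NR Δ → Prop}
    (hrep : ∀ A A' : ABox NC NR Δ, A.Finite → rep A A' → A' ⊆ A ∧ Consistent K.tbox A')
    {extra : ABox NC NR Δ → ABox NC NR Δ}
    (hextra : ∀ A, ∀ φ ∈ extra A, ∃ c ∈ L, φ = .concept .viol c) :
    (generate K.initState (K.RepairStep temp rep extra)).RunBounded := by
  have hfresh : ∀ A, extra A ⊆ freshFacts NC NR (insert temp L) := fun A φ hφ => by
    obtain ⟨c, hc, h⟩ := hextra A φ hφ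
    exact ⟨c, .inr hc, .inr h⟩
  -- The marker is present after every action step, so an unmarked state is initial or freshly
  -- repaired. Therefore actions are executed only in consistent states. Finiteness is carried along
  -- for the sake of `hrep`.
  have hinv : ∀ s, Relation.ReflTransGen (K.RepairStep temp rep extra) K.initState s →
      s.abox.Finite ∧ (marker temp ∉ s.abox → Consistent K.tbox s.abox) := by
    intro s hs
    induction hs with
    | refl => exact ⟨K.finite_initState, fun _ => K.consistent₀⟩
    | tail _ hstep ih =>
      cases hstep with
      | action s' α σ hm hα hex =>
        exact ⟨(hex.finite_abox ih.1).union (Set.finite_singleton _),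
          fun h => absurd (Set.mem_union_right _ rfl) h⟩
      | repair A' hm hr =>
        have hfin := ih.1.subset (Set.sdiff_subset (t := {marker temp}))
        obtain ⟨h1, h2⟩ := hrep _ _ hfin hr
        refine ⟨(hfin.subset h1).union ((hL.image (Fact.concept ConceptName.viol)).subset ?_),
          fun _ => h2.union_fresh (hfresh _)⟩
        intro φ hφ
        obtain ⟨c, hc, rfl⟩ := hextra _ φ hφ
        exact ⟨c, hc, rfl⟩
  refine hK.generate_runBounded (hL.insert temp) fun s s' hs hstep => ?_
  obtain ⟨hfin, hcons⟩ := hinv s hs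
  cases hstep with
  | action s' α σ hm hα hex =>
    refine .action s' α σ (hcons hm) hα hex rfl (Set.union_subset_union_right _ ?_)
    rintro _ rfl
    exact ⟨temp, .inl rfl, .inl rfl⟩
  | repair A' hm hr =>
    refine .remove rfl (Set.union_subset_union ?_ (hfresh _))
    exact (hrep _ _ (hfin.subset Set.sdiff_subset) hr).1.trans Set.sdiff_subset

end Values

end KABs

open KABs in
theorem theorem5 {NC NR FN Δ : Type u} [Finite FN] [Countable Δ] [Infinite Δ]
    (K : KABs.KAB NC NR FN Δ) (hK : K.WeaklyAcyclic)
    (temp : Δ) (label : KABs.Assertion NC NR → Δ) :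
    K.standardTS.RunBounded ∧
    (K.boldTS temp).RunBounded ∧
    (K.certainTS temp).RunBounded ∧
    (K.extBoldTS temp label).RunBounded ∧
    (K.extCertainTS temp label).RunBounded := by
  have hbold : ∀ A A' : ABox NC NR Δ, A.Finite → IsBoldRepair K.tbox A A' →
      A' ⊆ A ∧ Consistent K.tbox A' := fun _ _ _ h => h.prop
  have hcertain : ∀ A A' : ABox NC NR Δ, A.Finite → IsCertainRepair K.tbox A A' →
      A' ⊆ A ∧ Consistent K.tbox A' := fun _ _ hA h => h.subset_and_consistent hA
  -- The extended repairs can add only labels of the finitely many assertions of the TBox to the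
  -- active domain.
  have hlabels : (label '' ↑K.tbox.assertions).Finite := K.tbox.assertions.finite_toSet.image label
  have hviol : ∀ A : ABox NC NR Δ, ∀ φ ∈ violFacts label K.tbox A,
      ∃ c ∈ label '' ↑K.tbox.assertions, φ = .concept .viol c := by
    rintro A φ ⟨t, ht, -, rfl⟩
    exact ⟨_, ⟨t, ht, rfl⟩, rfl⟩
  exact ⟨hK.standardTS_runBounded,
    hK.repair_runBounded temp Set.finite_empty hbold fun _ _ h => h.elim,
    hK.repair_runBounded temp Set.finite_empty hcertain fun _ _ h => h.elim,
    hK.repair_runBounded temp hlabels hbold hviol,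
    hK.repair_runBounded temp hlabels hcertain hviol⟩
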